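/- **Setting.** A *tiling* $T$ of $\mathbb{R}^d$ is a set of (possibly labelled) tiles, each a nonempty compact set equal to the closure of its interior, which cover $\mathbb{R}^d$ and have pairwise disjoint interiors. Let $[B_t(x)]_T$ be the patch of all tiles of $T$ that meet the open ball of radius $t$ about $x$. Two tilings are close if, up to a small translation, they agree on a large ball about the origin; the *tiling space* $\Omega$ of $T$ is the closure of $\{T-x : x\in\mathbb{R}^d\}$. The *Gähler approximant* $K_t$ ($t\in\mathbb{R}$) is the quotient space of $\Omega\times\mathbb{R}^d$ by the relation $(S,x)\sim_t(S',y)\iff[B_t(x)]_S-x=[B_t(y)]_{S'}-y$. Let $\pi_t:\mathbb{R}^d\to K_t$ send $x$ to the class of $(T,x)$, and for $s\le t$ let $f:K_t\to K_s$ be the forgetful map. The fundamental group $\pi_1(K_t)$ is based at $\pi_t(0)$. Let $G$ be any topological group (for example, any group with the discrete topology). A *flat principal $G$-bundle* over a space $X$ is a space $P$ over $X$ with charts $U_i\times G\cong P|_{U_i}$, where the open sets $U_i$ cover $X$, whose transition functions are left multiplications by locally constant functions $U_i\cap U_j\to G$; $G$ acts on the right of $P$ by right multiplication in charts. Paths in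 $P$ whose $G$-coordinate is locally constant in every chart are called horizontal. A homomorphism $\rho:\pi_1(X,x_0)\to G$ is a *holonomy* of $P$ if, for some point $z_0$ over $x_0$, the horizontal lift from $z_0$ of each loop $\gamma$ at $x_0$ ends at $z_0\cdot\rho([\gamma])$ (where in $\pi_1$ the product $[\gamma][\delta]$ is the class of $\delta$ followed by $\gamma$). A set $U\subseteq\mathbb{R}^d$ is *PE with radius $t$* if $x\in U$ and $[B_t(x)]_T-x=[B_t(y)]_T-y$ imply $y\in U$; a function $h$ on $U$ is *PE with radius $t$* if $h(x)=h(y)$ for all $x,y\in U$ with $[B_t(x)]_T-x=[B_t(y)]_T-y$. A *flat PE principal $G$-bundle over $T$ with radius $t>0$* is a flat principal $G$-bundle over $\mathbb{R}^d$ whose chart domains and transition functions are PE with radius $t$. Two such bundles, of radii $p$ and $r$, are *equivalent* if for some $s>\max(p,r)$ there is a homeomorphism between them over $\mathbb{R}^d$ which in charts is left multiplication by locally constant functions that are PE with radius $s$. $PREP(T)$ is the set of equivalence classes. **Theorem 1.1.** Let $t_0\le t_1\le t_2\le\cdots$ be a sequence of real numbers with $t_n\to\infty$. Then there is a bijection $$PREP(T)\;\cong\;\varinjlim_{f^*}\mathrm{Hom}(\pi_1(K_{t_n}),G)/G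 ,$$ where $G$ acts by conjugation and the maps $f^*$ are induced by the forgetful maps. It is given by pulling back bundles along $\pi_{t_n}$ and taking holonomy: if a flat PE principal $G$-bundle $P$ over $T$ is a pullback along $\pi_{t_n}$ (that is, there is a map $P\to Q$ covering $\pi_{t_n}$ which in charts is left multiplication by locally constant functions that are PE with radius $t_n$) of a flat principal $G$-bundle $Q$ over $K_{t_n}$ with holonomy $\rho$, then the class of $P$ corresponds to the class of $\rho$ at stage $n$. Moreover, every flat PE principal $G$-bundle of radius at most $t_n$ is such a pullback of some $Q$ that has some holonomy $\rho$. -/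

import Mathlib

open Set Filter Topology

universe u v

/-! ## Tilings -/

/-- Euclidean `d`-space. -/
abbrev Space (d : ℕ) : Type := EuclideanSpace ℝ (Fin d)

/-- A (labelled) tile: a set of points together with a label (colour). -/
@[ext]
structure Tile (d : ℕ) (L : Type v) where
  carrier : Set (Space d)
  label : L

/-- The tile `τ + v`. -/
def Tile.translate {d : ℕ} {L : Type v} (v : Space d) (τ : Tile d L) : Tile d L where
  carrier := Homeomorph.addRight v '' τ.carrier
  label := τ.label

theorem Tile.translate_zero {d : ℕ} {L : Type v} (τ : Tile d L) : τ.translate 0 = τ := by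
  ext x
  · simp [Tile.translate]
  · rfl

theorem Tile.translate_translate {d : ℕ} {L : Type v} (v w : Space d) (τ : Tile d L) :
    (τ.translate v).translate w = τ.translate (v + w) := by
  ext x
  · simp [Tile.translate, add_assoc]
  · rfl

theorem Tile.translate_injective {d : ℕ} {L : Type v} (v : Space d) :
    Function.Injective (Tile.translate (L := L) v) := by
  intro σ τ h
  have h' := congrArg (Tile.translate (-v)) h
  simpa [Tile.translate_translate, Tile.translate_zero] using h'

/-- A tiling of `ℝ^d`: a set of tiles, each of them a nonempty compact set which is the closure of
its interior, which cover `ℝ^d` and have pairwise disjoint interiors. -/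
structure Tiling (d : ℕ) (L : Type v) where
  tiles : Set (Tile d L)
  nonempty : ∀ τ ∈ tiles, τ.carrier.Nonempty
  isCompact : ∀ τ ∈ tiles, IsCompact τ.carrier
  regular : ∀ τ ∈ tiles, closure (interior τ.carrier) = τ.carrier
  cover : ∀ x, ∃ τ ∈ tiles, x ∈ τ.carrier
  packing : ∀ σ ∈ tiles, ∀ τ ∈ tiles, σ ≠ τ → Disjoint (interior σ.carrier) (interior τ.carrier)

namespace Tiling

variable {d : ℕ} {L : Type v}

/-- The tiling `T + v`. -/
def translate (v : Space d) (T : Tiling d L) : Tiling d L where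
  tiles := Tile.translate v '' T.tiles
  nonempty := by
    rintro _ ⟨τ, hτ, rfl⟩
    exact (T.nonempty τ hτ).image _
  isCompact := by
    rintro _ ⟨τ, hτ, rfl⟩
    exact (T.isCompact τ hτ).image (Homeomorph.continuous _)
  regular := by
    rintro _ ⟨τ, hτ, rfl⟩
    simp only [Tile.translate]
    rw [← Homeomorph.image_interior, ← Homeomorph.image_closure, T.regular τ hτ]
  cover := by
    intro x
    obtain ⟨τ, hτ, hx⟩ := T.cover (x - v)
    exact ⟨_, ⟨τ, hτ, rfl⟩, x - v, hx, by simp⟩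
  packing := by
    rintro _ ⟨σ, hσ, rfl⟩ _ ⟨τ, hτ, rfl⟩ h
    simp only [Tile.translate]
    rw [← Homeomorph.image_interior, ← Homeomorph.image_interior]
    exact (disjoint_image_iff (Homeomorph.injective _)).2
      (T.packing σ hσ τ hτ fun h' => h (by rw [h']))

/-- The patch `[B_t(x)]` of `T`: all tiles of `T` that meet the (open) ball `B_t(x)`.  As tiles are
closures of their interiors, this is the smallest set of tiles of `T` that covers the ball. -/
def patch (T : Tiling d L) (x : Space d) (t : ℝ) : Set (Tile d L) :=
  {τ ∈ T.tiles | (τ.carrier ∩ Metric.ball x t).Nonempty}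

/-- The translated patch `[B_t(x)] - x`. -/
def view (T : Tiling d L) (x : Space d) (t : ℝ) : Set (Tile d L) :=
  Tile.translate (-x) '' T.patch x t

theorem mem_view {T : Tiling d L} {x : Space d} {t : ℝ} {τ : Tile d L} :
    τ ∈ T.view x t ↔ τ.translate x ∈ T.tiles ∧ (τ.carrier ∩ Metric.ball 0 t).Nonempty := by
  constructor
  · rintro ⟨σ, ⟨hσ, y, hy, hyt⟩, rfl⟩
    refine ⟨by simpa [Tile.translate_translate, Tile.translate_zero] using hσ,
      y - x, ⟨y, hy, by simp [sub_eq_add_neg]⟩, ?_⟩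
    rwa [mem_ball_zero_iff, ← mem_ball_iff_norm]
  · rintro ⟨h, y, hy, hyt⟩
    refine ⟨τ.translate x, ⟨h, y + x, ⟨y, hy, by simp⟩, ?_⟩,
      by simp [Tile.translate_translate, Tile.translate_zero]⟩
    simpa [mem_ball_iff_norm] using hyt

/-- Agreement of patches up to radius `t` implies agreement up to every smaller radius. -/
theorem view_eq_of_le {S T : Tiling d L} {x y : Space d} {s t : ℝ} (hst : s ≤ t)
    (h : S.view x t = T.view y t) : S.view x s = T.view y s := by
  ext τ
  have h' := Set.ext_iff.1 h τ
  simp only [mem_view] at h' ⊢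
  constructor
  · rintro ⟨h1, h2⟩
    exact ⟨(h'.1 ⟨h1, h2.mono (inter_subset_inter_right _ (Metric.ball_subset_ball hst))⟩).1, h2⟩
  · rintro ⟨h1, h2⟩
    exact ⟨(h'.2 ⟨h1, h2.mono (inter_subset_inter_right _ (Metric.ball_subset_ball hst))⟩).1, h2⟩

/-- `S'` is `ε`-close to `S`: after a translation of length less than `ε`, the tiling `S'` agrees
with `S` on the ball of radius `1/ε` about the origin. -/
def Close (ε : ℝ) (S S' : Tiling d L) : Prop :=
  ∃ v : Space d, ‖v‖ < ε ∧ (S'.translate v).view 0 ε⁻¹ = S.view 0 ε⁻¹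

theorem Close.mono {ε δ : ℝ} (hε : 0 < ε) (h : ε ≤ δ) {S S' : Tiling d L}
    (hS : Close ε S S') : Close δ S S' := by
  obtain ⟨v, hv, hS⟩ := hS
  exact ⟨v, hv.trans_le h, view_eq_of_le (inv_anti₀ hε h) hS⟩

/-- The tiling topology: two tilings are close if they agree on a large ball about the origin
up to a small translation. -/
instance : TopologicalSpace (Tiling d L) where
  IsOpen O := ∀ S ∈ O, ∃ ε > 0, ∀ S', Close ε S S' → S' ∈ O
  isOpen_univ := fun _ _ => ⟨1, one_pos, fun _ _ => trivial⟩
  isOpen_inter := by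
    rintro O O' hO hO' S ⟨hS, hS'⟩
    obtain ⟨ε, hε, h⟩ := hO S hS
    obtain ⟨ε', hε', h'⟩ := hO' S hS'
    have h0 : 0 < min ε ε' := lt_min hε hε'
    exact ⟨min ε ε', h0, fun S' hc =>
      ⟨h S' (hc.mono h0 (min_le_left _ _)), h' S' (hc.mono h0 (min_le_right _ _))⟩⟩
  isOpen_sUnion := by
    rintro C hC S ⟨O, hO, hS⟩
    obtain ⟨ε, hε, h⟩ := hC O hO S hS
    exact ⟨ε, hε, fun S' hc => ⟨O, hO, h S' hc⟩⟩

/-- The tiling space `Ω` of `T`: the closure of the translation orbit of `T`. -/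
def hull (T : Tiling d L) : Set (Tiling d L) :=
  closure (range fun x : Space d => T.translate (-x))

theorem translate_zero (T : Tiling d L) : T.translate 0 = T := by
  have h : Tile.translate (L := L) (0 : Space d) = id := funext Tile.translate_zero
  cases T
  simp [translate, h]

theorem self_mem_hull (T : Tiling d L) : T ∈ T.hull :=
  subset_closure ⟨0, by simp [translate_zero]⟩

/-! ## The approximants -/

/-- The total space `E = {(S, x) : S ∈ Ω, x ∈ S}` of the tautological bundle over `Ω`, whose fibre
over `S` is `S` itself, viewed as a marked copy of `ℝ^d`. -/
abbrev Tautological (T : Tiling d L) : Type v := T.hull × Space d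

/-- `(S, x) ↔_t (S', y)` if `[B_t(x)]_S - x = [B_t(y)]_{S'} - y`. -/
def approxSetoid (T : Tiling d L) (t : ℝ) : Setoid T.Tautological where
  r a b := a.1.1.view a.2 t = b.1.1.view b.2 t
  iseqv := ⟨fun _ => rfl, fun h => h.symm, fun h h' => h.trans h'⟩

/-- The approximant `K_t`, with the quotient topology. -/
abbrev Approximant (T : Tiling d L) (t : ℝ) : Type v := Quotient (T.approxSetoid t)

/-- The projection `π_t : ℝ^d → K_t`, sending `x` to the class of `x ∈ T`. -/
def proj (T : Tiling d L) (t : ℝ) (x : Space d) : T.Approximant t :=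
  Quotient.mk (T.approxSetoid t) (⟨T, T.self_mem_hull⟩, x)

/-- The forgetful map `K_t → K_s` for `s ≤ t`. -/
def forget (T : Tiling d L) {s t : ℝ} (h : s ≤ t) : C(T.Approximant t, T.Approximant s) where
  toFun := Quotient.map' (s₁ := T.approxSetoid t) (s₂ := T.approxSetoid s) id
    fun _ _ hab => view_eq_of_le h hab
  continuous_toFun := continuous_id.quotient_map' _

/-- The fundamental group of `K_t`, based at the class of the origin of `T` (the space `K_t` is
path connected, and the forgetful maps preserve this base point). -/
abbrev ApproxGroup (T : Tiling d L) (t : ℝ) : Type v :=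
  FundamentalGroup (T.Approximant t) (T.proj t 0)

/-- The homomorphism `π₁(K_t) → π₁(K_s)` induced by the forgetful map, for `s ≤ t`. -/
noncomputable def forgetHom (T : Tiling d L) {s t : ℝ} (h : s ≤ t) : T.ApproxGroup t →* T.ApproxGroup s :=
  FundamentalGroup.map (T.forget h) (T.proj t 0)

end Tiling

/-! ## Representation varieties and their direct limit -/

/-- Conjugacy of homomorphisms `H → G`. -/
def conjSetoid (H : Type v) (G : Type u) [Group H] [Group G] : Setoid (H →* G) where
  r ρ σ := ∃ g : G, ∀ x, σ x = g * ρ x * g⁻¹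
  iseqv := by
    refine ⟨fun ρ => ⟨1, by simp⟩, ?_, ?_⟩
    · rintro ρ σ ⟨g, h⟩
      exact ⟨g⁻¹, fun x => by rw [h]; group⟩
    · rintro ρ σ τ ⟨g, h⟩ ⟨g', h'⟩
      exact ⟨g' * g, fun x => by rw [h', h]; group⟩

/-- The representation variety `Hom(H, G)/G`. -/
abbrev RepVariety (H : Type v) (G : Type u) [Group H] [Group G] : Type (max u v) :=
  Quotient (conjSetoid H G)

/-- The class in `Hom(H, G)/G` of a homomorphism. -/
def RepVariety.mk {H : Type v} {G : Type u} [Group H] [Group G] (ρ : H →* G) : RepVariety H G :=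
  Quotient.mk (conjSetoid H G) ρ

/-- A homomorphism `H' → H` induces a map `Hom(H, G)/G → Hom(H', G)/G` by precomposition. -/
def RepVariety.comap {H H' : Type v} (G : Type u) [Group H] [Group H'] [Group G] (φ : H' →* H) :
    RepVariety H G → RepVariety H' G :=
  Quotient.map' (s₁ := conjSetoid H G) (s₂ := conjSetoid H' G) (fun ρ => ρ.comp φ)
    fun _ _ ⟨g, h⟩ => ⟨g, fun x => h (φ x)⟩

namespace Tiling

variable {d : ℕ} {L : Type v}

theorem forgetHom_refl (T : Tiling d L) (t : ℝ) (a : T.ApproxGroup t) :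
    T.forgetHom le_rfl a = a := by
  have h : T.forget (le_refl t) = ContinuousMap.id _ := by
    ext x
    induction x using Quotient.inductionOn
    rfl
  induction a using Quotient.inductionOn with
  | h γ =>
    change Path.Homotopic.Quotient.mk (γ.map (T.forget (le_refl t)).continuous) = _
    refine congrArg Path.Homotopic.Quotient.mk (Path.ext (funext fun s => ?_))
    exact congrArg (fun f => f (γ s)) h

theorem forgetHom_forgetHom (T : Tiling d L) {r s t : ℝ} (h : r ≤ s) (h' : s ≤ t)
    (a : T.ApproxGroup t) :
    T.forgetHom h (T.forgetHom h' a) = T.forgetHom (h.trans h') a := by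
  induction a using Quotient.inductionOn with
  | h γ =>
    change Path.Homotopic.Quotient.mk ((γ.map (T.forget h').continuous).map
      (T.forget h).continuous) = Path.Homotopic.Quotient.mk (γ.map (T.forget (h.trans h')).continuous)
    refine congrArg Path.Homotopic.Quotient.mk (Path.ext (funext fun x => ?_))
    have key : ∀ z, T.forget h (T.forget h' z) = T.forget (h.trans h') z := by
      intro z
      induction z using Quotient.inductionOn
      rfl
    exact key (γ x)

/-- The set `Hom(π₁(K_t), G)/G`. -/
abbrev Rep (T : Tiling d L) (G : Type u) [Group G] (t : ℝ) : Type (max u v) :=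
  RepVariety (T.ApproxGroup t) G

/-- The map `f^* : Hom(π₁(K_s), G)/G → Hom(π₁(K_t), G)/G` induced by the forgetful map
`f : K_t → K_s`, for `s ≤ t`. -/
noncomputable def repMap (T : Tiling d L) (G : Type u) [Group G] {s t : ℝ} (h : s ≤ t) :
    T.Rep G s → T.Rep G t :=
  RepVariety.comap G (T.forgetHom h)

instance (T : Tiling d L) (G : Type u) [Group G] (s t : ℝ) :
    FunLike (T.Rep G s → T.Rep G t) (T.Rep G s) (T.Rep G t) where
  coe f := f
  coe_injective := fun _ _ h => h

/-- The directed system `Hom(π₁(K_{t_0}), G)/G → Hom(π₁(K_{t_1}), G)/G → ⋯`. -/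
instance repSystem (T : Tiling d L) (G : Type u) [Group G] (t : ℕ → ℝ) (ht : Monotone t) :
    DirectedSystem (fun n => T.Rep G (t n)) (fun _ _ h => T.repMap G (ht h)) where
  map_self := by
    intro n x
    induction x using Quotient.inductionOn with
    | h ρ => exact congrArg (Quotient.mk _) (MonoidHom.ext fun a =>
        congrArg ρ (T.forgetHom_refl (t n) a))
  map_map := by
    intro k j i hij hjk x
    induction x using Quotient.inductionOn with
    | h ρ => exact congrArg (Quotient.mk _) (MonoidHom.ext fun a =>
        congrArg ρ (T.forgetHom_forgetHom (ht hij) (ht hjk) a))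

/-- The direct limit of the sets `Hom(π₁(K_{t_n}), G)/G` along the maps `f^*`. -/
noncomputable abbrev RepLimit (T : Tiling d L) (G : Type u) [Group G] (t : ℕ → ℝ) (ht : Monotone t) :
    Type (max u v) :=
  DirectLimit (fun n => T.Rep G (t n)) (fun _ _ h => T.repMap G (ht h))

/-- The element of the direct limit represented by `ρ : π₁(K_{t_n}) → G`. -/
noncomputable def RepLimit.mk (T : Tiling d L) {G : Type u} [Group G] (t : ℕ → ℝ) (ht : Monotone t) (n : ℕ)
    (ρ : T.ApproxGroup (t n) →* G) : T.RepLimit G t ht :=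
  Quotient.mk _ ⟨n, RepVariety.mk ρ⟩

end Tiling

/-! ## Flat principal bundles -/

/-- `f` is locally constant on the set `s` (with its subspace topology). -/
def LocConstOn {X Y : Type*} [TopologicalSpace X] (f : X → Y) (s : Set X) : Prop :=
  IsLocallyConstant (s.domRestrict f)

/-- Let `e`, `e'` be charts of bundles with fibre `G` and let `F` be a map between their total
spaces.  In these charts `F` has the form `(x, a) ↦ (f x, h x * a)`, where `f` is the map of base
spaces that `F` covers. -/
def HasCoord {X Y P Q G : Type*} [TopologicalSpace X] [TopologicalSpace Y] [TopologicalSpace P]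
    [TopologicalSpace Q] [Mul G] [TopologicalSpace G] {p : P → X} {q : Q → Y}
    (e : Bundle.Trivialization G p) (e' : Bundle.Trivialization G q) (F : P → Q) (h : X → G) :
    Prop :=
  ∀ z : P, p z ∈ e.baseSet → q (F z) ∈ e'.baseSet → (e' (F z)).2 = h (p z) * (e z).2

theorem locConstOn_iff {X Y : Type*} [TopologicalSpace X] {f : X → Y} {s : Set X} :
    LocConstOn f s ↔ ∀ x ∈ s, ∀ᶠ y in 𝓝[s] x, f y = f x := by
  rw [LocConstOn, IsLocallyConstant.iff_eventually_eq, Subtype.forall]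
  refine forall₂_congr fun x hx => ?_
  rw [nhdsWithin_eq_map_subtype_coe hx, Filter.eventually_map]
  rfl

theorem HasCoord.eq_coord {X Y P Q G : Type*} [TopologicalSpace X] [TopologicalSpace Y]
    [TopologicalSpace P] [TopologicalSpace Q] [MulOneClass G] [TopologicalSpace G] {p : P → X}
    {q : Q → Y} {e : Bundle.Trivialization G p} {e' : Bundle.Trivialization G q} {F : P → Q}
    {h : X → G} (H : HasCoord e e' F h) {x : X} (hx : x ∈ e.baseSet)
    (hx' : q (F (e.toOpenPartialHomeomorph.symm (x, 1))) ∈ e'.baseSet) :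
    h x = (e' (F (e.toOpenPartialHomeomorph.symm (x, 1)))).2 := by
  have hz : p (e.toOpenPartialHomeomorph.symm (x, 1)) = x := e.proj_symm_apply' hx
  rw [H _ (by rwa [hz]) hx', e.apply_symm_apply' hx, hz, mul_one]

/-- A flat principal `G`-bundle over `X`: a space over `X` with an atlas of charts `U_i × G`, whose
transition functions are left multiplications by locally constant functions `U_i ∩ U_j → G`. -/
structure FlatBundle (X : Type v) [TopologicalSpace X] (G : Type u) [Group G]
    [TopologicalSpace G] where
  total : Type (max u v)
  [top : TopologicalSpace total]
  proj : total → X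
  ι : Type (max u v)
  chart : ι → Bundle.Trivialization G proj
  cover : ∀ x, ∃ i, x ∈ (chart i).baseSet
  transition : ∀ i j, ∃ h : X → G, HasCoord (chart i) (chart j) id h ∧
    LocConstOn h ((chart i).baseSet ∩ (chart j).baseSet)

attribute [instance] FlatBundle.top

namespace FlatBundle

variable {X : Type v} [TopologicalSpace X] {G : Type u} [Group G] [TopologicalSpace G]

/-- The right action of `G` on the total space induced by right multiplication in the charts. -/
noncomputable def act (P : FlatBundle X G) (z : P.total) (g : G) : P.total :=
  (P.chart (P.cover (P.proj z)).choose).toOpenPartialHomeomorph.symm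
    (P.proj z, (P.chart (P.cover (P.proj z)).choose z).2 * g)

theorem proj_act (P : FlatBundle X G) (z : P.total) (g : G) : P.proj (P.act z g) = P.proj z :=
  Bundle.Trivialization.proj_symm_apply' _ (P.cover (P.proj z)).choose_spec

/-- In every chart, the right action is right multiplication. -/
theorem chart_act (P : FlatBundle X G) (i : P.ι) (z : P.total) (g : G)
    (hz : P.proj z ∈ (P.chart i).baseSet) :
    (P.chart i (P.act z g)).2 = (P.chart i z).2 * g := by
  have hj := (P.cover (P.proj z)).choose_spec
  obtain ⟨h, hh, -⟩ := P.transition (P.cover (P.proj z)).choose i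
  have h1 := hh (P.act z g) (by rwa [P.proj_act]) (by simpa [P.proj_act] using hz)
  have h2 := hh z hj hz
  have h3 : P.chart (P.cover (P.proj z)).choose (P.act z g) = _ :=
    Bundle.Trivialization.apply_symm_apply' _ hj
  simp only [id] at h1 h2
  rw [h1, h3, h2, P.proj_act, mul_assoc]

/-- The induced right action is free and transitive on the fibres. -/
theorem existsUnique_act (P : FlatBundle X G) (z z' : P.total) (h : P.proj z' = P.proj z) :
    ∃! g, P.act z g = z' := by
  obtain ⟨i, hi⟩ := P.cover (P.proj z)
  refine ⟨(P.chart i z).2⁻¹ * (P.chart i z').2, ?_, ?_⟩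
  · refine (P.chart i).injOn ?_ ?_ ?_
    · rw [Bundle.Trivialization.mem_source, P.proj_act]; exact hi
    · rw [Bundle.Trivialization.mem_source, h]; exact hi
    · refine Prod.ext ?_ ?_
      · change (P.chart i _).1 = (P.chart i _).1
        rw [Bundle.Trivialization.coe_fst', Bundle.Trivialization.coe_fst', P.proj_act, h]
        · rwa [h]
        · rwa [P.proj_act]
      · change (P.chart i _).2 = (P.chart i _).2
        rw [P.chart_act i z _ hi]
        simp
  · rintro g rfl
    simp [P.chart_act i z g hi]

/-- A path in the total space is horizontal (a flat lift of its projection) if its `G`-coordinate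
is locally constant in every chart. -/
def IsHorizontal (P : FlatBundle X G) (c : C(unitInterval, P.total)) : Prop :=
  ∀ i, LocConstOn (fun s => (P.chart i (c s)).2) {s | P.proj (c s) ∈ (P.chart i).baseSet}

/-- `ρ : π₁(X, x₀) → G` is a holonomy homomorphism of `P`: for some point `z₀` of the fibre over
`x₀`, the horizontal lift starting at `z₀` of any loop `γ` at `x₀` ends at `z₀ · ρ([γ])`.
(In Mathlib, the product `[γ] * [δ]` in `π₁` is the class of `δ` followed by `γ`.) -/
def HasHolonomy (P : FlatBundle X G) (x₀ : X) (ρ : FundamentalGroup X x₀ →* G) : Prop :=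
  ∃ z₀ : P.total, P.proj z₀ = x₀ ∧ ∀ γ : Path x₀ x₀, ∃ c : C(unitInterval, P.total),
    P.IsHorizontal c ∧ (∀ s, P.proj (c s) = γ s) ∧ c 0 = z₀ ∧
      c 1 = P.act z₀ (ρ (FundamentalGroup.fromPath (Path.Homotopic.Quotient.mk γ)))

end FlatBundle

/-! ## Pattern equivariant bundles -/

namespace Tiling

variable {d : ℕ} {L : Type v}

/-- The set `U` is invariant under `[B_t(x)] - x = [B_t(y)] - y`. -/
def IsPESet (T : Tiling d L) (t : ℝ) (U : Set (Space d)) : Prop :=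
  ∀ x ∈ U, ∀ y, T.view x t = T.view y t → y ∈ U

/-- `f` is a PE function with radius `t` on the set `U`. -/
def IsPEOn {Y : Type*} (T : Tiling d L) (t : ℝ) (f : Space d → Y) (U : Set (Space d)) : Prop :=
  ∀ x ∈ U, ∀ y ∈ U, T.view x t = T.view y t → f x = f y

/-- A flat PE principal `G`-bundle over `T`: a flat principal `G`-bundle over `ℝ^d` such that, for
some radius `t > 0`, the chart domains are PE open sets with radius `t` and the transition functions
are PE functions with radius `t`. -/
structure PEBundle (T : Tiling d L) (G : Type u) [Group G] [TopologicalSpace G]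
    extends FlatBundle (Space d) G where
  radius : ℝ
  radius_pos : 0 < radius
  isPESet : ∀ i, T.IsPESet radius (chart i).baseSet
  transition_isPEOn : ∀ i j, ∃ h : Space d → G, HasCoord (chart i) (chart j) id h ∧
    T.IsPEOn radius h ((chart i).baseSet ∩ (chart j).baseSet)

namespace PEBundle

variable {T : Tiling d L} {G : Type u} [Group G] [TopologicalSpace G]

/-- `P` and `R` are isomorphic as flat PE bundles with radius `s`: there is a homeomorphism
`P → R` over `ℝ^d` which in the charts of `P` and `R` has the form `(x, a) ↦ (x, h x * a)` with
`h` locally constant and PE with radius `s`. -/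
def IsoAt (s : ℝ) (P R : PEBundle T G) : Prop :=
  ∃ F : P.total ≃ₜ R.total, (∀ z, R.proj (F z) = P.proj z) ∧
    ∀ i k, ∃ h : Space d → G, HasCoord (P.chart i) (R.chart k) F h ∧
      LocConstOn h ((P.chart i).baseSet ∩ (R.chart k).baseSet) ∧
      T.IsPEOn s h ((P.chart i).baseSet ∩ (R.chart k).baseSet)

/-- Two PE bundles are equivalent if they are isomorphic as bundles with radius `s`, for some `s`
bigger than both radii. -/
def Equivalent (P R : PEBundle T G) : Prop :=
  ∃ s, P.radius < s ∧ R.radius < s ∧ IsoAt s P R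

theorem Equivalent.refl (P : PEBundle T G) : Equivalent P P := by
  refine ⟨P.radius + 1, by linarith, by linarith, Homeomorph.refl _, fun _ => rfl, fun i k => ?_⟩
  obtain ⟨h, hc, hl⟩ := P.transition i k
  obtain ⟨h', hc', hp⟩ := P.transition_isPEOn i k
  have key : ∀ x ∈ (P.chart i).baseSet ∩ (P.chart k).baseSet, h x = h' x := by
    rintro x ⟨hx, hx'⟩
    have hz : P.proj ((P.chart i).toOpenPartialHomeomorph.symm (x, 1)) = x :=
      (P.chart i).proj_symm_apply' hx
    rw [hc.eq_coord hx (by simpa [hz] using hx'), hc'.eq_coord hx (by simpa [hz] using hx')]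
  refine ⟨h, hc, hl, fun x hx y hy hxy => ?_⟩
  rw [key x hx, key y hy]
  exact hp x hx y hy (view_eq_of_le (by linarith) hxy)

theorem Equivalent.symm {P R : PEBundle T G} (h : Equivalent P R) : Equivalent R P := by
  obtain ⟨s, hs, hs', F, hF, H⟩ := h
  have hF' : ∀ w, P.proj (F.symm w) = R.proj w := fun w => by rw [← hF, F.apply_symm_apply]
  refine ⟨s, hs', hs, F.symm, hF', fun i k => ?_⟩
  obtain ⟨h, hc, hl, hp⟩ := H k i
  refine ⟨fun x => (h x)⁻¹, fun w hw hw' => ?_, ?_, fun x hx y hy hxy => ?_⟩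
  · have := hc (F.symm w) hw' (by simpa using hw)
    rw [F.apply_symm_apply, hF'] at this
    simp [this]
  · rw [inter_comm]
    exact hl.comp fun a => a⁻¹
  · exact congrArg _ (hp x hx.symm y hy.symm hxy)

theorem Equivalent.trans {P Q R : PEBundle T G} (h : Equivalent P Q) (h' : Equivalent Q R) :
    Equivalent P R := by
  obtain ⟨s, hs, hsQ, F, hF, H⟩ := h
  obtain ⟨s', hsQ', hs', F', hF', H'⟩ := h'
  refine ⟨max s s', lt_max_of_lt_left hs, lt_max_of_lt_right hs', F.trans F',
    fun z => by simp [hF, hF'], fun i k => ?_⟩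
  choose a hac hal hap using fun j => H i j
  choose b hbc hbl hbp using fun j => H' j k
  have key : ∀ j, ∀ z, P.proj z ∈ (P.chart i).baseSet → P.proj z ∈ (Q.chart j).baseSet →
      P.proj z ∈ (R.chart k).baseSet →
      (R.chart k (F' (F z))).2 = b j (P.proj z) * a j (P.proj z) * (P.chart i z).2 := by
    intro j z hi hj hk
    rw [hbc j (F z) (by rwa [hF]) (by rwa [hF', hF]), hac j z hi (by rwa [hF]), hF, mul_assoc]
  let m : Space d → G := fun x =>
    (R.chart k (F' (F ((P.chart i).toOpenPartialHomeomorph.symm (x, 1))))).2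
  have hm : ∀ j, ∀ x ∈ (P.chart i).baseSet, x ∈ (Q.chart j).baseSet → x ∈ (R.chart k).baseSet →
      m x = b j x * a j x := by
    intro j x hi hj hk
    have hz : P.proj ((P.chart i).toOpenPartialHomeomorph.symm (x, 1)) = x :=
      (P.chart i).proj_symm_apply' hi
    have := key j ((P.chart i).toOpenPartialHomeomorph.symm (x, 1)) (by rwa [hz]) (by rwa [hz])
      (by rwa [hz])
    rw [hz, (P.chart i).apply_symm_apply' hi, mul_one] at this
    exact this
  refine ⟨m, fun z hi hk => ?_, ?_, ?_⟩
  · obtain ⟨j, hj⟩ := Q.cover (P.proj z)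
    have hk' : P.proj z ∈ (R.chart k).baseSet := by
      simpa [hF, hF'] using hk
    rw [hm j _ hi hj hk']
    exact key j z hi hj hk'
  · rw [locConstOn_iff]
    rintro x ⟨hi, hk⟩
    obtain ⟨j, hj⟩ := Q.cover x
    have hU := (P.chart i).open_baseSet.mem_nhds hi
    have hV := (Q.chart j).open_baseSet.mem_nhds hj
    have hW := (R.chart k).open_baseSet.mem_nhds hk
    have ha := locConstOn_iff.1 (hal j) x ⟨hi, hj⟩
    have hb := locConstOn_iff.1 (hbl j) x ⟨hj, hk⟩
    rw [nhdsWithin_eq_nhds.2 (inter_mem hU hV)] at ha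
    rw [nhdsWithin_eq_nhds.2 (inter_mem hV hW)] at hb
    refine Filter.Eventually.filter_mono nhdsWithin_le_nhds ?_
    filter_upwards [hU, hV, hW, ha, hb] with y hyU hyV hyW hya hyb
    rw [hm j y hyU hyV hyW, hm j x hi hj hk, hya, hyb]
  · rintro x ⟨hi, hk⟩ y ⟨hi', hk'⟩ hxy
    obtain ⟨j, hj⟩ := Q.cover x
    have hj' := Q.isPESet j x hj y
      (view_eq_of_le (hsQ.le.trans (le_max_left s s')) hxy)
    rw [hm j x hi hj hk, hm j y hi' hj' hk',
      hap j x ⟨hi, hj⟩ y ⟨hi', hj'⟩ (view_eq_of_le (le_max_left s s') hxy),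
      hbp j x ⟨hj, hk⟩ y ⟨hj', hk'⟩ (view_eq_of_le (le_max_right s s') hxy)]

/-- `P` is a pullback of the flat bundle `Q` over `K_t` along `π_t : ℝ^d → K_t`: there is a bundle
map `P → Q` covering `π_t`, given in the charts of `P` and `Q` by functions that are locally
constant and PE with radius `t`. -/
def IsPullback (P : PEBundle T G) (t : ℝ) (Q : FlatBundle (T.Approximant t) G) : Prop :=
  ∃ F : P.total → Q.total, Continuous F ∧ (∀ z, Q.proj (F z) = T.proj t (P.proj z)) ∧
    ∀ i k, ∃ h : Space d → G, HasCoord (P.chart i) (Q.chart k) F h ∧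
      LocConstOn h ((P.chart i).baseSet ∩ T.proj t ⁻¹' (Q.chart k).baseSet) ∧
      T.IsPEOn t h ((P.chart i).baseSet ∩ T.proj t ⁻¹' (Q.chart k).baseSet)

end PEBundle

/-- Equivalence of flat PE principal `G`-bundles over `T`. -/
def peSetoid (T : Tiling d L) (G : Type u) [Group G] [TopologicalSpace G] :
    Setoid (T.PEBundle G) where
  r := PEBundle.Equivalent
  iseqv := ⟨PEBundle.Equivalent.refl, PEBundle.Equivalent.symm, PEBundle.Equivalent.trans⟩

/-- The PE representation variety of `T`. -/
abbrev PREP (T : Tiling d L) (G : Type u) [Group G] [TopologicalSpace G] : Type (u + 1) :=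
  Quotient (T.peSetoid G)

/-- The class in `PREP(T)` of a flat PE principal bundle. -/
def PREP.mk {T : Tiling d L} {G : Type u} [Group G] [TopologicalSpace G] (P : T.PEBundle G) :
    T.PREP G :=
  Quotient.mk (T.peSetoid G) P

end Tiling

-- A set or function is PE with radius `t` exactly when it descends along `π_t : ℝ^d → K_t`. Every
-- patch of a tiling in `Ω` occurs in `T`, so `π_t` is surjective and even a quotient map
-- (`isQuotientMap_proj`), and local constancy can be tested upstairs. Hence PE bundles of radius at
-- most `t`, and isomorphisms of them that are PE with radius `t`, descend to flat bundles and flat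
-- maps over `K_t` (`exists_models`, `Models.exists_mor`). As a quotient of `ℝ^d`, `K_t` is path
-- connected and locally path connected, so a flat bundle over it is determined by the conjugacy
-- class of its holonomy (`Gauge.exists_mor_of_hol`). This makes the map to the limit well defined
-- and injective.
--
-- Surjectivity is the delicate point. Small loops in `K_s` are not known to be null-homotopic, so a
-- given `ρ` on `π₁(K_s)` may not be a holonomy over `K_s`. For `s < t`, however, the forgetful map
-- `K_t → K_s` factors locally through `ℝ^d` (`exists_local_lift`), so it makes short paths with
-- common ends homotopic. Then `f^*ρ` is a holonomy over `K_t` (`Gauge.exists_hol_eq`), which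
-- suffices in the direct limit.
--
-- The bookkeeping uses gauges: a flat bundle is recorded by the chart coordinates `g i` of an
-- arbitrary, usually discontinuous, section. The cocycle identity for `g j * (g i)⁻¹` is then
-- automatic, and a flat map is a single `G`-valued function on the base.

universe w

/-! ## Locally constant functions on open sets -/

theorem locConstOn_iff_of_isOpen {X Y : Type*} [TopologicalSpace X] {f : X → Y} {s : Set X}
    (hs : IsOpen s) : LocConstOn f s ↔ ∀ x ∈ s, ∀ᶠ y in 𝓝 x, f y = f x := by
  rw [locConstOn_iff]
  refine forall₂_congr fun x hx => ?_
  rw [hs.nhdsWithin_eq hx]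

theorem LocConstOn.continuousOn {X Y : Type*} [TopologicalSpace X] [TopologicalSpace Y]
    {f : X → Y} {s : Set X} (hf : LocConstOn f s) : ContinuousOn f s :=
  fun x hx => (tendsto_congr' (locConstOn_iff.1 hf x hx)).2 tendsto_const_nhds

theorem LocConstOn.congr {X Y : Type*} [TopologicalSpace X] {f g : X → Y} {s : Set X}
    (hf : LocConstOn f s) (h : ∀ x ∈ s, g x = f x) : LocConstOn g s := by
  have : s.domRestrict g = s.domRestrict f := funext fun x => h x x.2
  rwa [LocConstOn, this]

theorem LocConstOn.preimage {X Y Z : Type*} [TopologicalSpace X] [TopologicalSpace Y] {f : Y → Z}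
    {s : Set Y} (hf : LocConstOn f s) {c : X → Y} (hc : Continuous c) :
    LocConstOn (fun x => f (c x)) (c ⁻¹' s) := by
  rw [locConstOn_iff] at hf ⊢
  intro x hx
  exact (hc.continuousWithinAt.tendsto_nhdsWithin (fun _ h => h)).eventually (hf (c x) hx)

/-- Along a quotient map, local constancy on open sets can be tested upstairs. -/
theorem Topology.IsQuotientMap.locConstOn_iff {X Y Z : Type*} [TopologicalSpace X]
    [TopologicalSpace Y] {p : X → Y} (hp : IsQuotientMap p) {f : Y → Z} {s : Set Y}
    (hs : IsOpen s) : LocConstOn f s ↔ LocConstOn (fun x => f (p x)) (p ⁻¹' s) := by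
  -- For discrete `Z` local constancy is continuity, which a quotient map detects on open sets.
  let _ : TopologicalSpace Z := ⊥
  have _ : DiscreteTopology Z := ⟨rfl⟩
  have key : ∀ {W : Type _} [TopologicalSpace W] (h : W → Z) (t : Set W),
      LocConstOn h t ↔ ContinuousOn h t := fun h t => by
    rw [LocConstOn, IsLocallyConstant.iff_continuous, continuousOn_iff_continuous_domRestrict]
  have key' : ∀ {W : Type _} [TopologicalSpace W] (h : W → Z) (t : Set W),
      LocConstOn h t ↔ ContinuousOn h t := fun h t => by
    rw [LocConstOn, IsLocallyConstant.iff_continuous, continuousOn_iff_continuous_domRestrict]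
  rw [key, key', hp.continuousOn_isOpen_iff hs]
  rfl

/-! ## Gauges -/

/-- A gauge: an open cover with `G`-valued functions on its members whose quotients are locally
constant on the overlaps.  It describes a flat principal bundle with a (not necessarily
continuous) section, through the coordinates of that section. -/
structure Gauge (X : Type v) [TopologicalSpace X] (G : Type u) [Group G] where
  ι : Type w
  V : ι → Set X
  g : ι → X → G
  isOpen : ∀ i, IsOpen (V i)
  cover : ∀ x, ∃ i, x ∈ V i
  locConst : ∀ i j, LocConstOn (fun x => g j x * (g i x)⁻¹) (V i ∩ V j)

namespace Gauge

variable {X : Type v} [TopologicalSpace X] {G : Type u} [Group G]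

/-- The bundle described by a gauge. -/
noncomputable def core (A : Gauge.{u, v, w} X G) [TopologicalSpace G] [ContinuousMul G] :
    FiberBundleCore A.ι X G where
  baseSet := A.V
  isOpen_baseSet := A.isOpen
  indexAt x := (A.cover x).choose
  mem_baseSet_at x := (A.cover x).choose_spec
  coordChange i j x a := A.g j x * (A.g i x)⁻¹ * a
  coordChange_self i x _ a := by simp
  continuousOn_coordChange i j := by
    refine ContinuousOn.mul ?_ continuousOn_snd
    exact (A.locConst i j).continuousOn.comp continuousOn_fst fun p hp => hp.1
  coordChange_comp i j k x _ a := by group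

/-- `v` describes a horizontal lift of the map `c` to the bundle given by the gauge. -/
def Hor (A : Gauge.{u, v, w} X G) {Y : Type*} [TopologicalSpace Y] (c : Y → X) (v : Y → G) : Prop :=
  ∀ i, LocConstOn (fun y => A.g i (c y) * v y) (c ⁻¹' A.V i)

variable {A : Gauge.{u, v, w} X G} {Y : Type*} [TopologicalSpace Y]

/-- A change of chart multiplies the coordinate by a locally constant factor, so one chart near each
point suffices. -/
theorem hor_of_eventually {c : Y → X} (hc : Continuous c) {v : Y → G}
    (h : ∀ y, ∃ i, c y ∈ A.V i ∧ ∀ᶠ z in 𝓝 y, A.g i (c z) * v z = A.g i (c y) * v y) :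
    A.Hor c v := by
  intro j
  rw [locConstOn_iff_of_isOpen ((A.isOpen j).preimage hc)]
  intro y hy
  obtain ⟨i, hi, h⟩ := h y
  have h2 := (locConstOn_iff_of_isOpen ((A.isOpen i).inter (A.isOpen j))).1
    (A.locConst i j) (c y) ⟨hi, hy⟩
  filter_upwards [h, hc.continuousAt.eventually h2] with z h1 h2
  calc A.g j (c z) * v z = (A.g j (c z) * (A.g i (c z))⁻¹) * (A.g i (c z) * v z) := by group
    _ = A.g j (c y) * v y := by rw [h1, h2]; group

theorem Hor.comp {c : Y → X} {v : Y → G} (h : A.Hor c v) {Z : Type*} [TopologicalSpace Z]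
    {k : Z → Y} (hk : Continuous k) : A.Hor (c ∘ k) (v ∘ k) :=
  fun i => (h i).preimage hk

theorem Hor.mul_right {c : Y → X} {v : Y → G} (h : A.Hor c v) (a : G) :
    A.Hor c (fun y => v y * a) := fun i => by
  have h1 : LocConstOn (fun y => A.g i (c y) * v y * a) (c ⁻¹' A.V i) :=
    IsLocallyConstant.comp (h i) fun b => b * a
  exact h1.congr fun y _ => (mul_assoc _ _ _).symm

/-- The chart factor cancels in the quotient. Over an interval this yields uniqueness of horizontal
lifts up to the right action. -/
theorem Hor.inv_mul_isLocallyConstant {c : Y → X} (hc : Continuous c) {v v' : Y → G}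
    (h : A.Hor c v) (h' : A.Hor c v') : IsLocallyConstant fun y => (v y)⁻¹ * v' y := by
  rw [IsLocallyConstant.iff_eventually_eq]
  intro y
  obtain ⟨i, hi⟩ := A.cover (c y)
  have ho := (A.isOpen i).preimage hc
  filter_upwards [(locConstOn_iff_of_isOpen ho).1 (h i) y hi,
    (locConstOn_iff_of_isOpen ho).1 (h' i) y hi] with z h1 h2
  calc (v z)⁻¹ * v' z = (A.g i (c z) * v z)⁻¹ * (A.g i (c z) * v' z) := by group
    _ = (v y)⁻¹ * v' y := by rw [h1, h2]; group

theorem Hor.inv_mul_eq {c : unitInterval → X} (hc : Continuous c) {v v' : unitInterval → G}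
    (h : A.Hor c v) (h' : A.Hor c v') (s t : unitInterval) :
    (v s)⁻¹ * v' s = (v t)⁻¹ * v' t :=
  (h.inv_mul_isLocallyConstant hc h').apply_eq_of_preconnectedSpace s t

/-- A continuous lift to the bundle with discrete structure group is horizontal. -/
theorem hor_of_lift [TopologicalSpace G] [DiscreteTopology G] {c : Y → X} (hc : Continuous c)
    {F : Y → A.core.TotalSpace} (hF : Continuous F) (hF' : ∀ y, (F y).proj = c y) :
    A.Hor c fun y => (A.g (A.core.indexAt (c y)) (c y))⁻¹ * (show G from (F y).2) := by
  intro i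
  have h : ContinuousOn (fun y => (A.core.localTriv i (F y)).2) (c ⁻¹' A.V i) := by
    refine continuous_snd.comp_continuousOn ?_
    refine (A.core.localTriv i).continuousOn.comp hF.continuousOn fun y hy => ?_
    rw [FiberBundleCore.mem_localTriv_source]
    change (F y).proj ∈ A.V i
    rw [hF']
    exact hy
  rw [locConstOn_iff_of_isOpen ((A.isOpen i).preimage hc)]
  intro y hy
  have h1 := h.continuousAt (((A.isOpen i).preimage hc).mem_nhds hy)
  filter_upwards [h1 (mem_nhds_discrete.2 (mem_singleton _))] with z hz
  have key : ∀ z, A.g i (c z) * ((A.g (A.core.indexAt (c z)) (c z))⁻¹ * (show G from (F z).2)) =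
      (A.core.localTriv i (F z)).2 := by
    intro z
    rw [FiberBundleCore.localTriv_apply]
    change _ = A.g i (F z).1 * (A.g (A.core.indexAt (F z).1) (F z).1)⁻¹ * (show G from (F z).2)
    rw [hF', mul_assoc]
  rw [key, key]
  exact hz

/-- Lifting of paths, with control over homotopies: the transport along a path. -/
theorem exists_transport (A : Gauge.{u, v, w} X G) {a b : X} : ∃ τ : Path a b → G,
    (∀ γ : Path a b, ∃ v : unitInterval → G, A.Hor γ v ∧ v 0 = 1 ∧ v 1 = τ γ) ∧
      ∀ γ γ' : Path a b, γ.Homotopic γ' → τ γ = τ γ' := by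
  -- Horizontality does not involve the topology of `G`. With the discrete topology the bundle is a
  -- covering, and path and homotopy lifting apply.
  let _ : TopologicalSpace G := ⊥
  have _ : DiscreteTopology G := ⟨rfl⟩
  have cov : IsCoveringMap A.core.proj := FiberBundle.isCoveringMap
  -- The point over `a` whose coordinate relative to the section of the gauge is `1`.
  let e : A.core.TotalSpace := ⟨a, A.g (A.core.indexAt a) a⟩
  let Γ : Path a b → C(unitInterval, A.core.TotalSpace) := fun γ =>
    cov.liftPath γ e γ.source
  have hΓ : ∀ γ s, (Γ γ s).proj = γ s := fun γ s =>
    congrFun (cov.liftPath_lifts γ.toContinuousMap e γ.source) s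
  have hΓ0 : ∀ γ, Γ γ 0 = e := fun γ => cov.liftPath_zero γ.toContinuousMap e γ.source
  refine ⟨fun γ => (A.g (A.core.indexAt (γ 1)) (γ 1))⁻¹ * (show G from (Γ γ 1).2), fun γ =>
    ⟨_, hor_of_lift γ.continuous (Γ γ).continuous (hΓ γ), ?_, rfl⟩, fun γ γ' h => ?_⟩
  · have h2 : (show G from (Γ γ 0).2) = A.g (A.core.indexAt a) a := by rw [hΓ0]
    rw [h2, γ.source]
    simp
  · have : Γ γ 1 = Γ γ' 1 := cov.liftPath_apply_one_eq_of_homotopicRel h e _ _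
    simp only [γ.target, γ'.target]
    exact congrArg (fun z : A.core.TotalSpace =>
      (A.g (A.core.indexAt b) b)⁻¹ * (show G from z.2)) this

/-- The parallel transport along a path. -/
noncomputable def transport (A : Gauge.{u, v, w} X G) {a b : X} (γ : Path a b) : G :=
  A.exists_transport.choose γ

theorem transport_homotopic {a b : X} {γ γ' : Path a b} (h : γ.Homotopic γ') :
    A.transport γ = A.transport γ' :=
  A.exists_transport.choose_spec.2 γ γ' h

theorem exists_hor (A : Gauge.{u, v, w} X G) {a b : X} (γ : Path a b) (x : G) :
    ∃ v : unitInterval → G, A.Hor γ v ∧ v 0 = x ∧ v 1 = A.transport γ * x := by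
  obtain ⟨v, hv, h0, h1⟩ := A.exists_transport.choose_spec.1 γ
  exact ⟨_, hv.mul_right x, by simp [h0], by rw [h1]; rfl⟩

theorem Hor.transport_mul {a b : X} {γ : Path a b} {v : unitInterval → G} (hv : A.Hor γ v) :
    A.transport γ * v 0 = v 1 := by
  obtain ⟨v', hv', h0, h1⟩ := A.exists_hor γ 1
  have h := hv'.inv_mul_eq γ.continuous hv 0 1
  rw [h0, h1] at h
  simp only [inv_one, one_mul, mul_one] at h
  rw [h]
  group

/-- Transport acts from the left, so the path travelled first stands on the right. This matches the
order of the product in `FundamentalGroup`, and `exists_hol` obtains a homomorphism. -/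
theorem transport_trans {a b c : X} (γ : Path a b) (δ : Path b c) :
    A.transport (γ.trans δ) = A.transport δ * A.transport γ := by
  obtain ⟨v, hv, h0, h1⟩ := A.exists_hor (γ.trans δ) 1
  -- The maps `k` and `l` run through the two halves of the interval; the lift restricted to each
  -- half is horizontal over `γ` and `δ`.
  let k : unitInterval → unitInterval := fun s => ⟨s / 2, by
    have := s.2.1; have := s.2.2; constructor <;> linarith⟩
  let l : unitInterval → unitInterval := fun s => ⟨(1 + s) / 2, by
    have := s.2.1; have := s.2.2; constructor <;> linarith⟩
  have hk : Continuous k := by fun_prop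
  have hl : Continuous l := by fun_prop
  have h2 : ⇑(γ.trans δ) ∘ k = γ := by
    funext s
    have := s.2.2
    have hs : ((k s : unitInterval) : ℝ) ≤ 1 / 2 := by simp only [k]; linarith
    rw [Function.comp_apply, Path.trans_apply, dif_pos hs]
    congr 1
    ext
    simp only [k]
    ring
  have h3 : ⇑(γ.trans δ) ∘ l = δ := by
    funext s
    have := s.2.1
    rw [Function.comp_apply, Path.trans_apply]
    split_ifs with hs
    · have h0 : (s : ℝ) = 0 := by simp only [l] at hs; linarith
      have h0' : s = 0 := Subtype.ext h0
      subst h0'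
      rw [δ.source]
      convert γ.target using 2
      ext
      simp [l]
    · congr 1
      ext
      simp only [l]
      ring
  have h4 := hv.comp hk
  have h5 := hv.comp hl
  rw [h2] at h4
  rw [h3] at h5
  have h6 := h4.transport_mul
  have h7 := h5.transport_mul
  have k0 : k 0 = 0 := by ext; simp [k]
  have k1 : l 0 = k 1 := by ext; simp [k, l]
  have l1 : l 1 = 1 := by ext; simp [l]
  simp only [Function.comp_apply, k0, k1, l1] at h6 h7
  rw [← h6, h0, h1] at h7
  simpa using h7.symm

theorem transport_refl (a : X) : A.transport (Path.refl a) = 1 := by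
  have h : A.Hor (Path.refl a) fun _ => (1 : G) := by
    refine hor_of_eventually (Path.refl a).continuous fun y => ?_
    obtain ⟨i, hi⟩ := A.cover a
    exact ⟨i, hi, Eventually.of_forall fun z => rfl⟩
  simpa using h.transport_mul

theorem transport_symm {a b : X} (γ : Path a b) : A.transport γ.symm = (A.transport γ)⁻¹ := by
  rw [eq_inv_iff_mul_eq_one, ← transport_trans, ← A.transport_refl a]
  exact transport_homotopic ⟨(Path.Homotopy.reflTransSymm γ).symm⟩

/-- The lift with constant coordinate in chart `i` is horizontal, so inside one chart transport
depends on the end points alone. -/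
theorem transport_of_mem {a b : X} (γ : Path a b) {i : A.ι} (h : ∀ s, γ s ∈ A.V i) :
    A.transport γ = (A.g i b)⁻¹ * A.g i a := by
  have hv : A.Hor γ fun s => (A.g i (γ s))⁻¹ * A.g i a := by
    refine hor_of_eventually γ.continuous fun y => ⟨i, h y, Eventually.of_forall fun z => ?_⟩
    simp
  simpa using hv.transport_mul

/-! ### Morphisms -/

/-- `m` describes a flat bundle map covering `f`. -/
def Mor {Y : Type*} [TopologicalSpace Y] (A : Gauge.{u, v, w} X G) (B : Gauge Y G)
    (f : X → Y) (m : X → G) : Prop :=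
  ∀ i j, LocConstOn (fun x => B.g j (f x) * m x * (A.g i x)⁻¹) (A.V i ∩ f ⁻¹' B.V j)

/-- A flat map carries horizontal lifts to horizontal lifts. -/
theorem Mor.transport {Y : Type*} [TopologicalSpace Y] {B : Gauge Y G} {f : C(X, Y)} {m : X → G}
    (h : A.Mor B f m) {a b : X} (γ : Path a b) :
    B.transport (γ.map f.continuous) * m a = m b * A.transport γ := by
  obtain ⟨v, hv, h0, h1⟩ := A.exists_hor γ 1
  have hm : B.Hor (γ.map f.continuous) fun s => m (γ s) * v s := by
    refine hor_of_eventually (γ.map f.continuous).continuous fun s => ?_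
    obtain ⟨j, hj⟩ := B.cover (f (γ s))
    obtain ⟨i, hi⟩ := A.cover (γ s)
    refine ⟨j, hj, ?_⟩
    have e1 := (locConstOn_iff_of_isOpen ((A.isOpen i).inter
      ((B.isOpen j).preimage f.continuous))).1 (h i j) (γ s) ⟨hi, hj⟩
    have e2 := (locConstOn_iff_of_isOpen ((A.isOpen i).preimage γ.continuous)).1 (hv i) s hi
    filter_upwards [γ.continuous.continuousAt.eventually e1, e2] with z e1 e2
    change B.g j (f (γ z)) * _ = B.g j (f (γ s)) * _
    calc B.g j (f (γ z)) * (m (γ z) * v z)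
        = B.g j (f (γ z)) * m (γ z) * (A.g i (γ z))⁻¹ * (A.g i (γ z) * v z) := by group
      _ = B.g j (f (γ s)) * (m (γ s) * v s) := by rw [e1, e2]; group
  have := hm.transport_mul
  simp only [h0, h1, γ.source, γ.target, mul_one] at this
  exact this

/-- Nearby points are joined by a path inside a single chart of each gauge, where both transports
are explicit; compatibility with them says that the coordinate of `m` does not change. -/
theorem mor_of_transport [LocallyPathConnectedSpace X] {A' : Gauge X G} {m : X → G}
    (h : ∀ {a b : X} (γ : Path a b), A'.transport γ * m a = m b * A.transport γ) :
    A.Mor A' id m := by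
  intro i j
  have ho := (A.isOpen i).inter (A'.isOpen j)
  refine (locConstOn_iff_of_isOpen ho).2 fun x hx => ?_
  obtain ⟨U, ⟨hU, hUc⟩, hUo⟩ := (LocallyPathConnectedSpace.path_connected_basis x).mem_iff.1
    (ho.mem_nhds hx)
  filter_upwards [hU] with y hy
  obtain ⟨γ, hγ⟩ := hUc.joinedIn x (mem_of_mem_nhds hU) y hy
  have := h γ
  rw [transport_of_mem γ fun s => (hUo (hγ s)).1, transport_of_mem γ fun s => (hUo (hγ s)).2] at this
  calc A'.g j y * m y * (A.g i y)⁻¹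
      = A'.g j y * (m y * ((A.g i y)⁻¹ * A.g i x)) * (A.g i x)⁻¹ := by group
    _ = A'.g j x * m x * (A.g i x)⁻¹ := by rw [← this]; group

/-! ### Holonomy -/

/-- `ρ` is a holonomy homomorphism of the bundle described by the gauge. -/
def Hol (A : Gauge.{u, v, w} X G) (x₀ : X) (ρ : FundamentalGroup X x₀ →* G) : Prop :=
  ∃ a : G, ∀ γ : Path x₀ x₀, A.transport γ * a =
    a * ρ (FundamentalGroup.fromPath (Path.Homotopic.Quotient.mk γ))

theorem exists_hol (A : Gauge.{u, v, w} X G) (x₀ : X) :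
    ∃ ρ : FundamentalGroup X x₀ →* G, A.Hol x₀ ρ := by
  let τ : FundamentalGroup X x₀ → G := Quotient.lift (fun γ : Path x₀ x₀ => A.transport γ)
    fun _ _ h => transport_homotopic h
  refine ⟨MonoidHom.mk' τ ?_, 1, fun γ => by simp; rfl⟩
  intro p q
  induction p using Quotient.inductionOn
  induction q using Quotient.inductionOn
  exact transport_trans _ _

theorem Hol.conj {x₀ : X} {ρ σ : FundamentalGroup X x₀ →* G} (h : A.Hol x₀ ρ)
    (hρ : (conjSetoid (FundamentalGroup X x₀) G).r ρ σ) : A.Hol x₀ σ := by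
  obtain ⟨a, ha⟩ := h
  obtain ⟨g, hg⟩ := hρ
  refine ⟨a * g⁻¹, fun γ => ?_⟩
  rw [← mul_assoc, ha, hg]
  group

/-- Flat bundle maps preserve the holonomy up to conjugacy. -/
theorem Hol.of_mor {Y : Type v} [TopologicalSpace Y] {B : Gauge Y G} {f : C(X, Y)} {m : X → G}
    (h : A.Mor B f m) {x₀ : X} {ρ : FundamentalGroup X x₀ →* G} (hρ : A.Hol x₀ ρ)
    {σ : FundamentalGroup Y (f x₀) →* G} (hσ : B.Hol (f x₀) σ) :
    (conjSetoid (FundamentalGroup X x₀) G).r ρ (σ.comp (FundamentalGroup.map f x₀)) := by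
  obtain ⟨a, ha⟩ := hρ
  obtain ⟨b, hb⟩ := hσ
  -- The flat map sends the reference point `a` to the point with coordinate `m x₀ * a`, which
  -- differs from `b` by this element.
  refine ⟨b⁻¹ * m x₀ * a, fun p => ?_⟩
  induction p using Quotient.inductionOn with
  | h γ =>
    have h1 := ha γ
    have h2 := hb (γ.map f.continuous)
    have h3 := h.transport γ
    change σ (FundamentalGroup.fromPath (Path.Homotopic.Quotient.mk (γ.map f.continuous))) =
      _ * ρ (FundamentalGroup.fromPath (Path.Homotopic.Quotient.mk γ)) * _
    generalize σ _ = s at *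
    generalize ρ _ = r at *
    have hs : s = b⁻¹ * (B.transport (γ.map f.continuous) * m x₀) * (m x₀)⁻¹ * b := by
      rw [mul_assoc, mul_assoc, mul_assoc, mul_inv_cancel_left, h2, inv_mul_cancel_left]
    have hr : r = a⁻¹ * (A.transport γ * a) := by rw [h1, inv_mul_cancel_left]
    rw [hs, hr, h3]
    group

/-- Over a path connected and locally path connected space, flat bundles with the same holonomy
are isomorphic. -/
theorem exists_mor_of_hol [PathConnectedSpace X] [LocallyPathConnectedSpace X] {A' : Gauge X G}
    {x₀ : X} {ρ : FundamentalGroup X x₀ →* G} (h : A.Hol x₀ ρ) (h' : A'.Hol x₀ ρ) :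
    ∃ m, A.Mor A' id m := by
  obtain ⟨a, ha⟩ := h
  obtain ⟨a', ha'⟩ := h'
  let p : ∀ x, Path x₀ x := fun x => PathConnectedSpace.somePath x₀ x
  -- Over `x₀`, left multiplication by `a' * a⁻¹` matches the reference points; transport along `p
  -- x` extends it. Compatibility with `γ` is equality of the two holonomies on the loop `p x`, `γ`,
  -- `p y` reversed.
  refine ⟨fun x => A'.transport (p x) * (a' * a⁻¹) * (A.transport (p x))⁻¹,
    mor_of_transport fun {x y} γ => ?_⟩
  have h1 := ha ((p x).trans (γ.trans (p y).symm))
  have h2 := ha' ((p x).trans (γ.trans (p y).symm))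
  simp only [transport_trans, transport_symm] at h1 h2
  generalize ρ _ = r at h1 h2
  have h3 : r = a⁻¹ * ((A.transport (p y))⁻¹ * A.transport γ * A.transport (p x) * a) := by
    rw [h1]; group
  have h4 : A'.transport γ = A'.transport (p y) * (a' * r) * a'⁻¹ * (A'.transport (p x))⁻¹ := by
    rw [← h2]; group
  rw [h4, h3]
  group

end Gauge

/-! ## Bundles with prescribed holonomy -/

section Realization

variable {X K : Type v} [TopologicalSpace X] [TopologicalSpace K] {G : Type u} [Group G]

/-- The extension of a homomorphism `ρ : π₁(K, k₀) → G` to paths, given paths `p k` from the base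
point to the points of `K`. -/
noncomputable def pathRep {k₀ : K} (ρ : FundamentalGroup K k₀ →* G) (p : ∀ k, Path k₀ k) {a b : K}
    (γ : Path a b) : G :=
  ρ (FundamentalGroup.fromPath (Path.Homotopic.Quotient.mk ((p a).trans (γ.trans (p b).symm))))

variable {k₀ : K} {ρ : FundamentalGroup K k₀ →* G} {p : ∀ k, Path k₀ k}

theorem pathRep_homotopic {a b : K} {γ γ' : Path a b} (h : γ.Homotopic γ') :
    pathRep ρ p γ = pathRep ρ p γ' := by
  refine congrArg ρ (congrArg FundamentalGroup.fromPath (Path.Homotopic.Quotient.eq.2 ?_))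
  exact (Path.Homotopic.refl _).hcomp (h.hcomp (Path.Homotopic.refl _))

theorem pathRep_trans {a b c : K} (γ : Path a b) (δ : Path b c) :
    pathRep ρ p (γ.trans δ) = pathRep ρ p δ * pathRep ρ p γ := by
  rw [pathRep, pathRep, pathRep, ← map_mul, FundamentalGroup.mul_def]
  congr 1
  simp only [Path.Homotopic.Quotient.mk_trans, Path.Homotopic.Quotient.mk_symm,
    Path.Homotopic.Quotient.trans_assoc]
  congr 2
  rw [← Path.Homotopic.Quotient.trans_assoc (Path.Homotopic.Quotient.mk (p b)).symm,
    Path.Homotopic.Quotient.symm_trans, Path.Homotopic.Quotient.refl_trans]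

/-- An idempotent of a group is trivial. -/
theorem pathRep_refl (a : K) : pathRep ρ p (Path.refl a) = 1 := by
  have h := pathRep_trans (ρ := ρ) (p := p) (Path.refl a) (Path.refl a)
  rw [pathRep_homotopic ⟨Path.Homotopy.reflTrans (Path.refl a)⟩] at h
  exact left_eq_mul.1 h

theorem pathRep_cast {a b a' b' : K} (γ : Path a b) (ha : a' = a) (hb : b' = b) :
    pathRep ρ p (γ.cast ha hb) = pathRep ρ p γ := by
  subst ha hb
  rfl

/-- If `f : X → K` identifies, up to homotopy, all short paths with the same end points, then the
homomorphisms that factor through `π₁(K)` are holonomies of flat bundles over `X`. -/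
theorem Gauge.exists_hol_eq [LocallyPathConnectedSpace X] [PathConnectedSpace K] (f : C(X, K))
    (x₀ : X) (ρ : FundamentalGroup K (f x₀) →* G)
    (hf : ∀ x, ∃ V, IsOpen V ∧ x ∈ V ∧ ∀ (a b : X) (γ γ' : Path a b), (∀ s, γ s ∈ V) →
      (∀ s, γ' s ∈ V) → (γ.map f.continuous).Homotopic (γ'.map f.continuous)) :
    ∃ A : Gauge.{u, v, v} X G, A.Hol x₀ (ρ.comp (FundamentalGroup.map f x₀)) := by
  have hf' : ∀ x, ∃ V, IsOpen V ∧ x ∈ V ∧ IsPathConnected V ∧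
      ∀ (a b : X) (γ γ' : Path a b), (∀ s, γ s ∈ V) →
      (∀ s, γ' s ∈ V) → (γ.map f.continuous).Homotopic (γ'.map f.continuous) := by
    intro x
    obtain ⟨V, hV, hx, h⟩ := hf x
    -- Path components of open sets are open here, so the neighbourhoods may be taken path
    -- connected.
    exact ⟨pathComponentIn V x, hV.pathComponentIn x, mem_pathComponentIn_self hx,
      isPathConnected_pathComponentIn hx, fun a b γ γ' h1 h2 => h a b γ γ'
        (fun s => pathComponentIn_subset (h1 s)) fun s => pathComponentIn_subset (h2 s)⟩
  choose V hVo hxV hVc hV using hf'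
  let p : ∀ k, Path (f x₀) k := fun k => PathConnectedSpace.somePath _ k
  let R : ∀ {a b : X}, Path a b → G := fun γ => pathRep ρ p (γ.map f.continuous)
  have R_homotopic : ∀ {a b : X} {γ γ' : Path a b}, γ.Homotopic γ' → R γ = R γ' :=
    fun h => pathRep_homotopic (h.map f)
  have R_trans : ∀ {a b c : X} (γ : Path a b) (δ : Path b c), R (γ.trans δ) = R δ * R γ := by
    intro a b c γ δ
    simp only [R, Path.map_trans]
    exact pathRep_trans _ _
  have R_small : ∀ {i : X} {a b : X} {γ γ' : Path a b}, (∀ s, γ s ∈ V i) → (∀ s, γ' s ∈ V i) →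
      R γ = R γ' := fun h h' => pathRep_homotopic (hV _ _ _ _ _ h h')
  have hj : ∀ {i a b}, a ∈ V i → b ∈ V i → ∃ γ : Path a b, ∀ s, γ s ∈ V i := by
    intro i a b ha hb
    obtain ⟨γ, hγ⟩ := (hVc i).joinedIn a ha b hb
    exact ⟨γ, hγ⟩
  classical
  -- On `V i`, `g i x` is the value of `R` on any path inside `V i` from `x` to the centre `i`; by
  -- `R_small` the path does not matter. The value `1` outside `V i` plays no role.
  let g : X → X → G := fun i x => if h : x ∈ V i then R (hj h (hxV i)).choose else 1
  have hg : ∀ {i a b} (γ : Path a b), (∀ s, γ s ∈ V i) → R γ = (g i b)⁻¹ * g i a := by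
    intro i a b γ hγ
    have ha : a ∈ V i := by simpa using hγ 0
    have hb : b ∈ V i := by simpa using hγ 1
    simp only [g, dif_pos ha, dif_pos hb]
    rw [eq_inv_mul_iff_mul_eq, ← R_trans]
    refine R_small (fun s => ?_) (hj ha (hxV i)).choose_spec
    rw [Path.trans_apply]
    split_ifs
    · exact hγ _
    · exact (hj hb (hxV i)).choose_spec _
  let A : Gauge.{u, v, v} X G :=
    { ι := X
      V := V
      g := g
      isOpen := hVo
      cover := fun x => ⟨x, hxV x⟩
      locConst := by
        intro i j
        have ho := (hVo i).inter (hVo j)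
        refine (locConstOn_iff_of_isOpen ho).2 fun x hx => ?_
        obtain ⟨U, ⟨hU, hUc⟩, hUo⟩ := (LocallyPathConnectedSpace.path_connected_basis x).mem_iff.1
          (ho.mem_nhds hx)
        filter_upwards [hU] with y hy
        obtain ⟨γ, hγ⟩ := hUc.joinedIn x (mem_of_mem_nhds hU) y hy
        have h1 := hg γ fun s => (hUo (hγ s)).1
        rw [hg γ fun s => (hUo (hγ s)).2] at h1
        calc g j y * (g i y)⁻¹ = g j y * ((g i y)⁻¹ * g i x) * (g i x)⁻¹ := by group
          _ = g j x * (g i x)⁻¹ := by rw [← h1]; group }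
  refine ⟨A, ?_⟩
  have key : ∀ γ : Path x₀ x₀, A.transport γ = R γ := by
    intro γ
    have _ : ContractibleSpace unitInterval :=
      (convex_Icc (0 : ℝ) 1).contractibleSpace ⟨0, by simp⟩
    have _ : LocallyPathConnectedSpace unitInterval :=
      (isQuotientMap_projIcc (a := (0 : ℝ)) (b := 1) (h := zero_le_one)).locallyPathConnectedSpace
    let c : ∀ s t : unitInterval, Path s t := fun s t => PathConnectedSpace.somePath s t
    -- The horizontal lift at time `s` is `R` of the piece of `γ` up to `s`. As the interval is
    -- simply connected, any path from `0` to `s` describes this piece.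
    have hv : A.Hor γ fun s => R ((c 0 s).map γ.continuous) := by
      refine Gauge.hor_of_eventually γ.continuous fun s => ⟨γ s, hxV _, ?_⟩
      have ho : IsOpen (γ ⁻¹' V (γ s)) := (hVo _).preimage γ.continuous
      obtain ⟨U, ⟨hU, hUc⟩, hUo⟩ := (LocallyPathConnectedSpace.path_connected_basis s).mem_iff.1
        (ho.mem_nhds (hxV (γ s)))
      filter_upwards [hU] with t ht
      obtain ⟨δ, hδ⟩ := hUc.joinedIn s (mem_of_mem_nhds hU) t ht
      have h1 := hg (δ.map γ.continuous) fun r => hUo (hδ r)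
      have h2 : R ((c 0 t).map γ.continuous) =
          R (((c 0 s).map γ.continuous).trans (δ.map γ.continuous)) := by
        rw [← Path.map_trans]
        exact R_homotopic ((SimplyConnectedSpace.paths_homotopic (c 0 t) ((c 0 s).trans δ)).map
          γ.toContinuousMap)
      change g _ _ * _ = g _ _ * _
      rw [h2, R_trans, h1]
      group
    have h0 : R ((c 0 0).map γ.continuous) = 1 := by
      rw [← pathRep_refl (ρ := ρ) (p := p) (f (γ 0))]
      exact pathRep_homotopic (((SimplyConnectedSpace.paths_homotopic (c 0 0)
        (Path.refl 0)).map γ.toContinuousMap).map f)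
    have h1 : R ((c 0 1).map γ.continuous) = R γ := by
      have e : (Path.mk (ContinuousMap.id unitInterval) rfl rfl : Path (0 : unitInterval) 1).map
        γ.continuous = γ.cast γ.source γ.target := by ext; rfl
      have := R_homotopic ((SimplyConnectedSpace.paths_homotopic (c 0 1)
        (Path.mk (ContinuousMap.id unitInterval) rfl rfl)).map γ.toContinuousMap)
      refine this.trans ?_
      change R ((Path.mk (ContinuousMap.id unitInterval) rfl rfl :
        Path (0 : unitInterval) 1).map γ.continuous) = _
      rw [e]
      exact pathRep_cast (γ.map f.continuous) (congrArg f γ.source) (congrArg f γ.target)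
    have := hv.transport_mul
    rw [h0, h1] at this
    simpa using this
  -- The chosen path `p (f x₀)` is a loop that need not be trivial, and `pathRep` conjugates by it;
  -- the reference point absorbs this.
  refine ⟨ρ (FundamentalGroup.fromPath (Path.Homotopic.Quotient.mk (p (f x₀)).symm)), fun γ => ?_⟩
  rw [key]
  have : ρ.comp (FundamentalGroup.map f x₀)
      (FundamentalGroup.fromPath (Path.Homotopic.Quotient.mk γ)) =
      ρ (FundamentalGroup.fromPath (Path.Homotopic.Quotient.mk (γ.map f.continuous))) := rfl
  rw [this, ← map_mul]
  simp only [R, pathRep]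
  rw [← map_mul, FundamentalGroup.mul_def, FundamentalGroup.mul_def]
  congr 1
  simp only [Path.Homotopic.Quotient.mk_trans, Path.Homotopic.Quotient.mk_symm]
  rw [← Path.Homotopic.Quotient.trans_assoc, Path.Homotopic.Quotient.symm_trans,
    Path.Homotopic.Quotient.refl_trans]

end Realization

/-! ## Gauges of flat bundles -/

namespace FlatBundle

variable {X : Type v} [TopologicalSpace X] {G : Type u} [Group G] [TopologicalSpace G]

/-- The functions `g i` are the chart coordinates of a section of `Q`. -/
def IsGauge (Q : FlatBundle X G) (g : Q.ι → X → G) : Prop :=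
  ∀ i j, HasCoord (Q.chart i) (Q.chart j) id fun x => g j x * (g i x)⁻¹

theorem exists_chart_symm_eq (Q : FlatBundle X G) {i : Q.ι} {x : X} (hx : x ∈ (Q.chart i).baseSet)
    (a : G) : ∃ z, Q.proj z = x ∧ (Q.chart i z).2 = a :=
  ⟨(Q.chart i).toOpenPartialHomeomorph.symm (x, a), (Q.chart i).proj_symm_apply' hx, by
    rw [(Q.chart i).apply_symm_apply' hx]⟩

theorem eq_of_chart_eq (Q : FlatBundle X G) {i : Q.ι} {z z' : Q.total}
    (hz : Q.proj z ∈ (Q.chart i).baseSet) (h : Q.proj z = Q.proj z')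
    (h' : (Q.chart i z).2 = (Q.chart i z').2) : z = z' := by
  have hz' : Q.proj z' ∈ (Q.chart i).baseSet := h ▸ hz
  refine (Q.chart i).injOn ((Q.chart i).mem_source.2 hz) ((Q.chart i).mem_source.2 hz')
    (Prod.ext ?_ h')
  exact ((Q.chart i).coe_fst' hz).trans (h.trans ((Q.chart i).coe_fst' hz').symm)

/-- One arbitrary point in each fibre suffices: the section need not be continuous, so nothing
obstructs it. -/
theorem exists_isGauge (Q : FlatBundle X G) : ∃ g, Q.IsGauge g := by
  choose i hi using Q.cover
  choose e he _ using fun x => Q.exists_chart_symm_eq (hi x) 1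
  refine ⟨fun j x => (Q.chart j (e x)).2, fun j k => ?_⟩
  obtain ⟨h, hc, -⟩ := Q.transition j k
  intro z hz hz'
  have h1 := hc (e (Q.proj z)) (by rwa [he]) (by simpa [he] using hz')
  have h2 := hc z hz hz'
  simp only [id, he] at h1 h2 ⊢
  rw [h1, h2]
  group

variable {Q : FlatBundle X G} {g : Q.ι → X → G}

theorem IsGauge.eq_of_hasCoord (hg : Q.IsGauge g) {i j : Q.ι} {h : X → G}
    (hc : HasCoord (Q.chart i) (Q.chart j) id h) {x : X} (hx : x ∈ (Q.chart i).baseSet)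
    (hx' : x ∈ (Q.chart j).baseSet) : g j x * (g i x)⁻¹ = h x := by
  have hz : Q.proj ((Q.chart i).toOpenPartialHomeomorph.symm (x, 1)) = x :=
    (Q.chart i).proj_symm_apply' hx
  rw [(hg i j).eq_coord hx (by simpa [hz] using hx'), hc.eq_coord hx (by simpa [hz] using hx')]

/-- A gauge of a flat bundle, as a gauge over the base space. -/
def IsGauge.toGauge (hg : Q.IsGauge g) : Gauge.{u, v, max u v} X G where
  ι := Q.ι
  V i := (Q.chart i).baseSet
  g := g
  isOpen i := (Q.chart i).open_baseSet
  cover := Q.cover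
  locConst i j := by
    obtain ⟨h, hc, hl⟩ := Q.transition i j
    exact hl.congr fun x hx => hg.eq_of_hasCoord hc hx.1 hx.2

/-- The coordinate of a point with respect to a gauge. -/
noncomputable def val (Q : FlatBundle X G) (g : Q.ι → X → G) (z : Q.total) : G :=
  (g (Q.cover (Q.proj z)).choose (Q.proj z))⁻¹ * (Q.chart (Q.cover (Q.proj z)).choose z).2

theorem IsGauge.chart_eq (hg : Q.IsGauge g) {i : Q.ι} {z : Q.total}
    (hz : Q.proj z ∈ (Q.chart i).baseSet) : (Q.chart i z).2 = g i (Q.proj z) * Q.val g z := by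
  rw [val, ← mul_assoc]
  exact hg _ i z (Q.cover (Q.proj z)).choose_spec hz

/-- The point over `x` with given coordinate. -/
noncomputable def pt (Q : FlatBundle X G) (g : Q.ι → X → G) (x : X) (a : G) : Q.total :=
  (Q.chart (Q.cover x).choose).toOpenPartialHomeomorph.symm (x, g (Q.cover x).choose x * a)

theorem proj_pt (x : X) (a : G) : Q.proj (Q.pt g x a) = x :=
  (Q.chart _).proj_symm_apply' (Q.cover x).choose_spec

theorem IsGauge.chart_pt (hg : Q.IsGauge g) {i : Q.ι} {x : X} (hx : x ∈ (Q.chart i).baseSet)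
    (a : G) : (Q.chart i (Q.pt g x a)).2 = g i x * a := by
  have h0 := (Q.cover x).choose_spec
  have h1 : (Q.chart (Q.cover x).choose (Q.pt g x a)).2 = g (Q.cover x).choose x * a := by
    rw [pt, (Q.chart _).apply_symm_apply' h0]
  have h2 := hg (Q.cover x).choose i (Q.pt g x a) (by rwa [proj_pt])
    (by simpa [proj_pt] using hx)
  simp only [id, proj_pt, h1] at h2
  rw [h2]
  group

theorem IsGauge.val_pt (hg : Q.IsGauge g) (x : X) (a : G) : Q.val g (Q.pt g x a) = a := by
  obtain ⟨i, hi⟩ := Q.cover x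
  have h1 := hg.chart_pt hi a
  rw [hg.chart_eq (by rwa [proj_pt]), proj_pt] at h1
  exact mul_left_cancel h1

theorem IsGauge.pt_val (hg : Q.IsGauge g) (z : Q.total) : Q.pt g (Q.proj z) (Q.val g z) = z := by
  obtain ⟨i, hi⟩ := Q.cover (Q.proj z)
  refine Q.eq_of_chart_eq (i := i) (by rwa [proj_pt]) (proj_pt _ _) ?_
  rw [hg.chart_pt hi, hg.chart_eq hi]

theorem IsGauge.val_act (hg : Q.IsGauge g) (z : Q.total) (a : G) :
    Q.val g (Q.act z a) = Q.val g z * a := by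
  obtain ⟨i, hi⟩ := Q.cover (Q.proj z)
  have h := Q.chart_act i z a hi
  rw [hg.chart_eq (by rwa [Q.proj_act]), Q.proj_act, hg.chart_eq hi, mul_assoc] at h
  exact mul_left_cancel h

theorem IsGauge.pt_act (hg : Q.IsGauge g) (x : X) (a b : G) :
    Q.act (Q.pt g x a) b = Q.pt g x (a * b) := by
  rw [← hg.pt_val (Q.act _ _), Q.proj_act, proj_pt, hg.val_act, hg.val_pt]

/-- Continuity of a map into a flat bundle can be tested in charts. -/
theorem continuous_of_chart {Y : Type*} [TopologicalSpace Y] {F : Y → Q.total} {f : Y → X}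
    (hf : Continuous f) (hF : ∀ y, Q.proj (F y) = f y)
    (h : ∀ y, ∃ i, f y ∈ (Q.chart i).baseSet ∧ ContinuousAt (fun z => (Q.chart i (F z)).2) y) :
    Continuous F := by
  refine continuous_iff_continuousAt.2 fun y => ?_
  obtain ⟨i, hi, h⟩ := h y
  have hs : F ⁻¹' (Q.chart i).source ∈ 𝓝 y := by
    filter_upwards [hf.continuousAt ((Q.chart i).open_baseSet.mem_nhds hi)] with z hz
    rw [mem_preimage, (Q.chart i).mem_source, hF]
    exact hz
  refine ((Q.chart i).toOpenPartialHomeomorph.continuousAt_iff_continuousAt_comp_left hs).2 ?_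
  have h2 : ContinuousAt (fun z => (f z, (Q.chart i (F z)).2)) y := hf.continuousAt.prodMk h
  refine h2.congr ?_
  filter_upwards [hs] with z hz
  refine Prod.ext ?_ rfl
  rw [← hF]
  exact ((Q.chart i).coe_fst hz).symm

/-- A solution of `Hor` gives a path in the total space through `pt`; it is continuous for any
topology on `G`, because its chart coordinates are locally constant. -/
theorem IsGauge.hasHolonomy (hg : Q.IsGauge g) {x₀ : X} {ρ : FundamentalGroup X x₀ →* G}
    (h : hg.toGauge.Hol x₀ ρ) : Q.HasHolonomy x₀ ρ := by
  obtain ⟨a, ha⟩ := h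
  refine ⟨Q.pt g x₀ a, proj_pt _ _, fun γ => ?_⟩
  obtain ⟨v, hv, h0, h1⟩ := hg.toGauge.exists_hor γ a
  have hc : Continuous fun s => Q.pt g (γ s) (v s) := by
    refine continuous_of_chart γ.continuous (fun s => proj_pt _ _) fun s => ?_
    obtain ⟨i, hi⟩ := Q.cover (γ s)
    have ho := ((Q.chart i).open_baseSet.preimage γ.continuous)
    refine ⟨i, hi, ((hv i).continuousOn.continuousAt (ho.mem_nhds hi)).congr ?_⟩
    filter_upwards [ho.mem_nhds hi] with t ht
    exact (hg.chart_pt ht _).symm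
  refine ⟨⟨_, hc⟩, fun i => ?_, fun s => proj_pt _ _, ?_, ?_⟩
  · have : {s | Q.proj (Q.pt g (γ s) (v s)) ∈ (Q.chart i).baseSet} =
        γ ⁻¹' (Q.chart i).baseSet := by
      ext s
      simp [proj_pt]
    simp only [ContinuousMap.coe_mk]
    rw [this]
    exact LocConstOn.congr (hv i) fun s hs => hg.chart_pt hs _
  · change Q.pt g (γ 0) (v 0) = _
    rw [γ.source, h0]
  · change Q.pt g (γ 1) (v 1) = _
    rw [γ.target, h1, ha, hg.pt_act]

theorem IsGauge.hol (hg : Q.IsGauge g) {x₀ : X} {ρ : FundamentalGroup X x₀ →* G}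
    (h : Q.HasHolonomy x₀ ρ) : hg.toGauge.Hol x₀ ρ := by
  obtain ⟨z₀, hz₀, h⟩ := h
  refine ⟨Q.val g z₀, fun γ => ?_⟩
  obtain ⟨c, hc, hp, h0, h1⟩ := h γ
  have hv : hg.toGauge.Hor γ fun s => Q.val g (c s) := by
    intro i
    have : {s | Q.proj (c s) ∈ (Q.chart i).baseSet} = γ ⁻¹' (Q.chart i).baseSet := by
      ext s
      simp [hp]
    have hi := hc i
    rw [this] at hi
    refine hi.congr fun s hs => ?_
    have := hg.chart_eq (i := i) (z := c s) (by rw [hp]; exact hs)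
    rw [hp] at this
    exact this.symm
  have := hv.transport_mul
  rwa [h0, h1, hg.val_act] at this

/-! ### Bundle maps -/

section Map

variable {Y : Type w} [TopologicalSpace Y] {R : FlatBundle Y G} {k : R.ι → Y → G}

/-- The coordinates of a bundle map, in terms of gauges. -/
theorem IsGauge.exists_coord (hg : Q.IsGauge g) (hk : R.IsGauge k) {f : X → Y}
    {F : Q.total → R.total} (hF : ∀ z, R.proj (F z) = f (Q.proj z)) :
    ∃ m : X → G, ∀ i j h, HasCoord (Q.chart i) (R.chart j) F h → ∀ x ∈ (Q.chart i).baseSet,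
      f x ∈ (R.chart j).baseSet → k j (f x) * m x * (g i x)⁻¹ = h x := by
  refine ⟨fun x => R.val k (F (Q.pt g x 1)), fun i j h hc x hx hx' => ?_⟩
  have h1 := hc (Q.pt g x 1) (by rwa [proj_pt]) (by rwa [hF, proj_pt])
  rw [hk.chart_eq (by rwa [hF, proj_pt]), hF, proj_pt, hg.chart_pt hx, mul_one] at h1
  rw [h1]
  group

/-- The bundle map with given coordinates. -/
noncomputable def mapOfCoord (Q : FlatBundle X G) (g : Q.ι → X → G) (R : FlatBundle Y G)
    (k : R.ι → Y → G) (f : X → Y) (m : X → G) (z : Q.total) : R.total :=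
  R.pt k (f (Q.proj z)) (m (Q.proj z) * Q.val g z)

theorem proj_mapOfCoord (f : X → Y) (m : X → G) (z : Q.total) :
    R.proj (Q.mapOfCoord g R k f m z) = f (Q.proj z) :=
  proj_pt _ _

theorem IsGauge.hasCoord_mapOfCoord (hg : Q.IsGauge g) (hk : R.IsGauge k) (f : X → Y) (m : X → G)
    (i : Q.ι) (j : R.ι) : HasCoord (Q.chart i) (R.chart j) (Q.mapOfCoord g R k f m)
      fun x => k j (f x) * m x * (g i x)⁻¹ := by
  intro z hz hz'
  rw [proj_mapOfCoord] at hz'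
  rw [mapOfCoord, hk.chart_pt hz', hg.chart_eq hz]
  group

theorem IsGauge.continuous_mapOfCoord [ContinuousMul G] (hg : Q.IsGauge g) (hk : R.IsGauge k)
    {f : X → Y} (hf : Continuous f) {m : X → G} (h : hg.toGauge.Mor hk.toGauge f m) :
    Continuous (Q.mapOfCoord g R k f m) := by
  have hp : Continuous Q.proj := continuous_iff_continuousAt.2 fun z => by
    obtain ⟨i, hi⟩ := Q.cover (Q.proj z)
    exact (Q.chart i).continuousAt_proj ((Q.chart i).mem_source.2 hi)
  refine continuous_of_chart (hf.comp hp) (fun z => proj_mapOfCoord _ _ _) fun z => ?_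
  obtain ⟨i, hi⟩ := Q.cover (Q.proj z)
  obtain ⟨j, hj⟩ := R.cover (f (Q.proj z))
  have ho : IsOpen ((Q.chart i).baseSet ∩ f ⁻¹' (R.chart j).baseSet) :=
    (Q.chart i).open_baseSet.inter ((R.chart j).open_baseSet.preimage hf)
  refine ⟨j, hj, ?_⟩
  have h1 : ContinuousAt (fun z => k j (f (Q.proj z)) * m (Q.proj z) * (g i (Q.proj z))⁻¹) z :=
    ContinuousAt.comp (f := Q.proj) (g := fun x => k j (f x) * m x * (g i x)⁻¹)
      ((h i j).continuousOn.continuousAt (ho.mem_nhds ⟨hi, hj⟩)) hp.continuousAt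
  have h2 : ContinuousAt (fun z => (Q.chart i z).2) z :=
    continuous_snd.continuousAt.comp ((Q.chart i).continuousAt ((Q.chart i).mem_source.2 hi))
  refine (h1.mul h2).congr ?_
  filter_upwards [hp.continuousAt (ho.mem_nhds ⟨hi, hj⟩)] with y hy
  refine (hg.hasCoord_mapOfCoord hk f m i j y hy.1 ?_).symm
  rw [proj_mapOfCoord]
  exact hy.2

/-- A bundle map over the identity with locally constant coordinates is a homeomorphism. -/
theorem IsGauge.exists_homeomorph [ContinuousMul G] {R : FlatBundle X G} {k : R.ι → X → G}
    (hg : Q.IsGauge g) (hk : R.IsGauge k) {m : X → G} (h : hg.toGauge.Mor hk.toGauge id m) :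
    ∃ F : Q.total ≃ₜ R.total, ∀ z, F z = Q.mapOfCoord g R k id m z := by
  have h' : hk.toGauge.Mor hg.toGauge id m⁻¹ := by
    intro j i
    have := IsLocallyConstant.comp (h i j) fun b => b⁻¹
    change LocConstOn (fun x => (k j x * m x * (g i x)⁻¹)⁻¹) _ at this
    rw [inter_comm] at this
    exact this.congr fun x _ => by
      change g i x * (m x)⁻¹ * (k j x)⁻¹ = _
      group
  refine ⟨⟨⟨Q.mapOfCoord g R k id m, R.mapOfCoord k Q g id m⁻¹, fun z => ?_, fun z => ?_⟩,
    hg.continuous_mapOfCoord hk continuous_id h, hk.continuous_mapOfCoord hg continuous_id h'⟩,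
    fun z => rfl⟩
  · rw [mapOfCoord, proj_mapOfCoord, mapOfCoord, hk.val_pt]
    simpa using hg.pt_val z
  · rw [mapOfCoord, proj_mapOfCoord, mapOfCoord, hg.val_pt]
    simpa using hk.pt_val z

end Map

end FlatBundle

/-! ### The bundle of a gauge -/

namespace Gauge

variable {X : Type v} [TopologicalSpace X] {G : Type u} [Group G] [TopologicalSpace G]
  [ContinuousMul G]

theorem hasCoord_core (A : Gauge.{u, v, w} X G) (i j : A.ι) :
    HasCoord (A.core.localTriv i) (A.core.localTriv j) id fun x => A.g j x * (A.g i x)⁻¹ := by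
  intro z _ _
  have key : ∀ a b c d : G, a * b⁻¹ * d = a * c⁻¹ * (c * b⁻¹ * d) := fun a b c d => by group
  exact key _ _ _ _

/-- The flat bundle described by a gauge. -/
noncomputable def toFlatBundle (A : Gauge.{u, v, max u v} X G) : FlatBundle X G where
  total := A.core.TotalSpace
  proj := A.core.proj
  ι := A.ι
  chart := A.core.localTriv
  cover := A.cover
  transition i j := ⟨_, A.hasCoord_core i j, A.locConst i j⟩

theorem isGauge_toFlatBundle (A : Gauge.{u, v, max u v} X G) : A.toFlatBundle.IsGauge A.g :=
  A.hasCoord_core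

theorem hasHolonomy_toFlatBundle {A : Gauge.{u, v, max u v} X G} {x₀ : X}
    {ρ : FundamentalGroup X x₀ →* G} (h : A.Hol x₀ ρ) : A.toFlatBundle.HasHolonomy x₀ ρ :=
  A.isGauge_toFlatBundle.hasHolonomy h

end Gauge

/-! ## The geometry of the approximants -/

/-- A nonempty compact set has a point that is extreme in the direction `a - b`, so a nonzero
translation by `a - b` cannot map the set into itself. -/
theorem Tile.translate_ne_self {d : ℕ} {L : Type v} {τ : Tile d L} (hτ : IsCompact τ.carrier)
    (hne : τ.carrier.Nonempty) {a b : Space d} (h : τ.translate a = τ.translate b) : a = b := by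
  have key : ∀ p ∈ τ.carrier, p + (a - b) ∈ τ.carrier := by
    intro p hp
    have h1 : p + a ∈ (τ.translate a).carrier := ⟨p, hp, rfl⟩
    rw [h] at h1
    obtain ⟨q, hq, hqp⟩ := h1
    have : q = p + (a - b) := by
      have : q + b = p + a := hqp
      rw [← add_sub_assoc, ← this, add_sub_cancel_right]
    rwa [← this]
  obtain ⟨p, hp, hmax⟩ := hτ.exists_isMaxOn hne
    (f := fun q : Space d => inner ℝ (a - b) q) (by fun_prop)
  have h1 := hmax (key p hp)
  simp only [mem_ofPred_eq, inner_add_right, real_inner_self_eq_norm_sq] at h1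
  have h2 : ‖a - b‖ = 0 := by nlinarith [norm_nonneg (a - b)]
  exact sub_eq_zero.1 (norm_eq_zero.1 h2)

namespace Tiling

variable {d : ℕ} {L : Type v}

theorem view_translate (T : Tiling d L) (a x : Space d) (t : ℝ) :
    (T.translate a).view x t = T.view (x - a) t := by
  ext τ
  rw [mem_view, mem_view]
  refine and_congr_left fun _ => ⟨?_, fun h => ⟨_, h, ?_⟩⟩
  · rintro ⟨σ, hσ, h⟩
    have : σ = τ.translate (x - a) := by
      apply Tile.translate_injective a
      rw [h, Tile.translate_translate, sub_add_cancel]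
    rwa [← this]
  · rw [Tile.translate_translate, sub_add_cancel]

/-- Points close to points with equal views have equal views, for a smaller radius. -/
theorem view_add {S T : Tiling d L} {x y u : Space d} {r s : ℝ} (h : S.view x r = T.view y r)
    (hu : ‖u‖ + s ≤ r) : S.view (x + u) s = T.view (y + u) s := by
  have key : ∀ {S T : Tiling d L} {x y : Space d}, S.view x r = T.view y r →
      S.view (x + u) s ⊆ T.view (y + u) s := by
    intro S T x y h τ hτ
    rw [mem_view] at hτ ⊢
    obtain ⟨h1, q, hq, hqs⟩ := hτ
    refine ⟨?_, q, hq, hqs⟩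
    have h2 : τ.translate u ∈ S.view x r := by
      rw [mem_view, Tile.translate_translate, add_comm u]
      refine ⟨h1, q + u, ⟨q, hq, rfl⟩, ?_⟩
      rw [mem_ball_zero_iff] at hqs ⊢
      linarith [norm_add_le q u]
    rw [h, mem_view, Tile.translate_translate, add_comm u] at h2
    exact h2.1
  exact (key h).antisymm (key h.symm)

/-! ### The tiling topology and the quotient topology of `K_t` -/

theorem close_iff {ε : ℝ} {S S' : Tiling d L} :
    Close ε S S' ↔ ∃ a : Space d, ‖a‖ < ε ∧ S'.view (-a) ε⁻¹ = S.view 0 ε⁻¹ := by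
  simp only [Close, view_translate, zero_sub]

theorem isOpen_setOf_close (S : Tiling d L) {ε : ℝ} (hε : 0 < ε) : IsOpen {S' | Close ε S S'} := by
  intro S' hS'
  obtain ⟨a, ha, h⟩ := close_iff.1 hS'
  have h0 : 0 < ε⁻¹ + ‖a‖ := by positivity
  -- The first bound keeps the sum of the two translations below `ε`; the second makes the ball of
  -- agreement large enough to contain the ball of radius `ε⁻¹` about `-a`.
  have hδ : 0 < min (ε - ‖a‖) (ε⁻¹ + ‖a‖)⁻¹ := lt_min (sub_pos.2 ha) (inv_pos.2 h0)
  refine ⟨_, hδ, fun S'' hS'' => ?_⟩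
  have hδ' := (le_inv_comm₀ hδ h0).1 (min_le_right _ _)
  have hδ'' := min_le_left (ε - ‖a‖) (ε⁻¹ + ‖a‖)⁻¹
  generalize min (ε - ‖a‖) (ε⁻¹ + ‖a‖)⁻¹ = δ at *
  obtain ⟨b, hb, h'⟩ := close_iff.1 hS''
  refine close_iff.2 ⟨a + b, (norm_add_le a b).trans_lt (by linarith), ?_⟩
  rw [← h, neg_add_rev, view_add h' (s := ε⁻¹) (u := -a) (by rw [norm_neg]; linarith), zero_add]

/-- Every tiling of the hull agrees with a translate of `T` on a given ball. -/
theorem exists_view_eq_of_mem_hull {S T : Tiling d L} (hS : S ∈ T.hull) (R : ℝ) :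
    ∃ y : Space d, ∀ x s, ‖x‖ + s ≤ R → S.view x s = T.view (x + y) s := by
  -- The maximum with `1` keeps the radius of agreement positive when `R ≤ 0`.
  have hε : 0 < (max R 1)⁻¹ := inv_pos.2 (lt_max_of_lt_right one_pos)
  obtain ⟨S', hS', y, rfl⟩ := mem_closure_iff.1 hS _ (S.isOpen_setOf_close hε)
    (close_iff.2 ⟨0, by simp, by simp⟩)
  obtain ⟨a, -, h⟩ := close_iff.1 hS'
  rw [inv_inv, view_translate] at h
  refine ⟨-a - -y, fun x s hx => ?_⟩
  rw [add_comm x, ← view_add h.symm (u := x) (hx.trans (le_max_left _ _)), zero_add]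

theorem continuous_proj (T : Tiling d L) (t : ℝ) : Continuous (T.proj t) :=
  continuous_quotient_mk'.comp (Continuous.prodMk continuous_const continuous_id)

theorem proj_eq_proj {T : Tiling d L} {t : ℝ} {x y : Space d} :
    T.proj t x = T.proj t y ↔ T.view x t = T.view y t :=
  Quotient.eq

theorem mk_eq_proj {T : Tiling d L} {t : ℝ} {S : T.hull} {x y : Space d}
    (h : S.1.view x t = T.view y t) : (Quotient.mk (T.approxSetoid t) (S, x)) = T.proj t y :=
  Quotient.sound h

/-- The class of `(S, x)` depends only on a bounded part of `S`, and such a part occurs in `T`. -/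
theorem surjective_proj (T : Tiling d L) (t : ℝ) : Function.Surjective (T.proj t) := by
  intro k
  induction k using Quotient.inductionOn with
  | h p =>
    obtain ⟨S, x⟩ := p
    obtain ⟨y, hy⟩ := exists_view_eq_of_mem_hull S.2 (‖x‖ + t)
    exact ⟨x + y, (mk_eq_proj (hy x t le_rfl)).symm⟩

/-- `K_t` carries the quotient topology of the projection from `ℝ^d`. -/
theorem isQuotientMap_proj (T : Tiling d L) (t : ℝ) : IsQuotientMap (T.proj t) := by
  refine (isQuotientMap_iff _).2 ⟨isCoinducing_iff.2 fun V =>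
    ⟨fun hV => ?_, fun hV => hV.preimage (T.continuous_proj t)⟩, T.surjective_proj t⟩
  refine isOpen_coinduced.2 (isOpen_iff_mem_nhds.2 ?_)
  rintro ⟨S, x⟩ hx
  -- The margin `2` pays for two displacements of length at most `1`: that of the point, `x' - x`,
  -- and that of the tiling, `a`.
  obtain ⟨y, hy⟩ := exists_view_eq_of_mem_hull S.2 (‖x‖ + |t| + 2)
  have ht := le_abs_self t
  have ht' := abs_nonneg t
  have hxy : x + y ∈ T.proj t ⁻¹' V := by
    rw [mem_preimage, ← mk_eq_proj (hy x t (by linarith))]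
    exact hx
  obtain ⟨δ, hδ, hball⟩ := Metric.isOpen_iff.1 hV _ hxy
  let R := ‖x‖ + |t| + 2
  have hR : 0 < R := by positivity
  -- With `δ / 2` for each displacement, the corresponding point of `T` stays in the ball of radius
  -- `δ`.
  let ε := min (min (δ / 2) 1) R⁻¹
  have hε : 0 < ε := lt_min (lt_min (half_pos hδ) one_pos) (inv_pos.2 hR)
  have hε1 : ε ≤ δ / 2 := (min_le_left _ _).trans (min_le_left _ _)
  have hε2 : ε ≤ 1 := (min_le_left _ _).trans (min_le_right _ _)
  have hε3 : R ≤ ε⁻¹ := (le_inv_comm₀ hR hε).2 (min_le_right _ _)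
  have hU : {S' : T.hull | Close ε S.1 S'.1} ∈ 𝓝 S :=
    ((S.1.isOpen_setOf_close hε).preimage continuous_subtype_val).mem_nhds
      (close_iff.2 ⟨0, by simpa using hε, by simp⟩)
  filter_upwards [prod_mem_nhds hU (Metric.ball_mem_nhds x hε)]
  rintro ⟨S', x'⟩ ⟨hS', hx'⟩
  obtain ⟨a, ha, h⟩ := close_iff.1 hS'
  rw [mem_ball_iff_norm] at hx'
  have hn : ‖x' + a‖ ≤ ‖x‖ + 2 := by
    have : x' + a = x + (x' - x) + a := by abel
    rw [this]
    linarith [norm_add_le (x + (x' - x)) a, norm_add_le x (x' - x)]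
  have h1 : S'.1.view x' t = T.view (x' + a + y) t := by
    have h2 := view_add h (u := x' + a) (s := t) (by linarith)
    rw [zero_add, show -a + (x' + a) = x' by abel] at h2
    rw [h2, hy _ _ (by linarith)]
  change Quotient.mk (T.approxSetoid t) (S', x') ∈ V
  rw [mk_eq_proj h1]
  refine hball ?_
  rw [mem_ball_iff_norm]
  have : x' + a + y - (x + y) = (x' - x) + a := by abel
  rw [this]
  linarith [norm_add_le (x' - x) a]

instance (T : Tiling d L) (t : ℝ) : PathConnectedSpace (T.Approximant t) :=
  (T.surjective_proj t).pathConnectedSpace (T.continuous_proj t)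

instance (T : Tiling d L) (t : ℝ) : LocallyPathConnectedSpace (T.Approximant t) :=
  (T.isQuotientMap_proj t).locallyPathConnectedSpace

/-- Points with the same view of positive radius are uniformly separated. -/
theorem exists_pos_eq_of_dist_lt (T : Tiling d L) (x : Space d) {r : ℝ} (hr : 0 < r) :
    ∃ δ > 0, ∀ y z, T.view y r = T.view x r → T.view z r = T.view x r → dist y z < δ → y = z := by
  obtain ⟨τ, hτ, hx⟩ := T.cover x
  have hσ : τ.translate (-x) ∈ T.view x r :=
    ⟨τ, ⟨hτ, x, hx, Metric.mem_ball_self hr⟩, rfl⟩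
  have hc : IsCompact (τ.translate (-x)).carrier :=
    (T.isCompact τ hτ).image (Homeomorph.continuous _)
  have hne : (τ.translate (-x)).carrier.Nonempty := (T.nonempty τ hτ).image _
  have hi : (interior (τ.translate (-x)).carrier).Nonempty := by
    simp only [Tile.translate]
    rw [← Homeomorph.image_interior]
    refine Nonempty.image _ (closure_nonempty_iff.1 ?_)
    rw [T.regular τ hτ]
    exact T.nonempty τ hτ
  generalize τ.translate (-x) = σ at *
  obtain ⟨p, hp⟩ := hi
  -- Both `σ + y` and `σ + z` are tiles of `T`. If `y` and `z` are closer than `δ`, their interiors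
  -- share the point `p + y`, so the tiles coincide and `y = z`.
  obtain ⟨δ, hδ, hb⟩ := Metric.isOpen_iff.1 isOpen_interior p hp
  have hint : ∀ a q, q ∈ interior σ.carrier → q + a ∈ interior (σ.translate a).carrier := by
    intro a q hq
    simp only [Tile.translate]
    rw [← Homeomorph.image_interior]
    exact ⟨q, hq, rfl⟩
  refine ⟨δ, hδ, fun y z hy hz hyz => Tile.translate_ne_self hc hne ?_⟩
  have hσ' := hσ
  rw [← hy, mem_view] at hσ
  rw [← hz, mem_view] at hσ'
  by_contra hcon
  refine disjoint_left.1 (T.packing _ hσ.1 _ hσ'.1 hcon) (hint y p hp) ?_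
  have : p + y = (p + (y - z)) + z := by abel
  rw [this]
  refine hint z _ (hb ?_)
  rwa [mem_ball_iff_norm, add_sub_cancel_left, ← dist_eq_norm]

/-- Locally, the forgetful map `K_t → K_s` factors through `ℝ^d` if `s < t`. -/
theorem exists_local_lift (T : Tiling d L) {s t : ℝ} (hst : s < t) (ht : 0 < t)
    (k : T.Approximant t) : ∃ V, IsOpen V ∧ k ∈ V ∧ ∃ w : T.Approximant t → Space d,
      ContinuousOn w V ∧ ∀ l ∈ V, T.proj s (w l) = T.forget hst.le l := by
  obtain ⟨x, rfl⟩ := T.surjective_proj t k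
  obtain ⟨r, hr, hrt⟩ := exists_between (max_lt hst ht)
  rw [max_lt_iff] at hr
  obtain ⟨δ₀, hδ₀, hsep⟩ := T.exists_pos_eq_of_dist_lt x hr.2
  -- Near a point with the `r`-view of `x`, `c y` denotes that point. The bound `δ₀ / 2` makes it
  -- unique, `t - r` makes `y - c y` depend only on the `t`-view of `y`, and `r - s` makes `x + (y -
  -- c y)` have the same `s`-view as `y`. So `y ↦ x + (y - c y)` descends to the required local map
  -- `K_t → ℝ^d`.
  let δ := min (δ₀ / 2) (min (r - s) (t - r))
  have hδ : 0 < δ := lt_min (half_pos hδ₀) (lt_min (sub_pos.2 hr.1) (sub_pos.2 hrt))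
  have hδ1 : δ ≤ δ₀ / 2 := min_le_left _ _
  have hδ2 : δ ≤ r - s := (min_le_right _ _).trans (min_le_left _ _)
  have hδ3 : δ ≤ t - r := (min_le_right _ _).trans (min_le_right _ _)
  let W : Set (Space d) := {y | ∃ z, T.view z r = T.view x r ∧ dist y z < δ}
  classical
  let c : Space d → Space d := fun y => if h : y ∈ W then h.choose else 0
  have hc : ∀ y ∈ W, T.view (c y) r = T.view x r ∧ dist y (c y) < δ := fun y hy => by
    simp only [c, dif_pos hy]
    exact hy.choose_spec
  have hceq : ∀ y z, T.view z r = T.view x r → dist y z < δ → y ∈ W ∧ c y = z := by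
    intro y z hz hyz
    have hy : y ∈ W := ⟨z, hz, hyz⟩
    refine ⟨hy, hsep _ _ (hc y hy).1 hz ?_⟩
    linarith [dist_triangle_left (c y) z y, (hc y hy).2]
  have hloc : ∀ y ∈ W, ∀ᶠ z in 𝓝 y, z ∈ W ∧ c z = c y := by
    intro y hy
    have : ∀ᶠ z in 𝓝 y, dist z (c y) < δ :=
      (continuous_id.dist continuous_const).continuousAt.eventually_lt continuousAt_const
        (hc y hy).2
    filter_upwards [this] with z hz
    exact hceq z (c y) (hc y hy).1 hz
  have hWo : IsOpen W := isOpen_iff_mem_nhds.2 fun y hy => (hloc y hy).mono fun z hz => hz.1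
  have hsat : ∀ y ∈ W, ∀ z, T.view y t = T.view z t → z ∈ W ∧ z - c z = y - c y := by
    intro y hy z hyz
    obtain ⟨h1, h2⟩ := hc y hy
    have h3 : T.view (z + (c y - y)) r = T.view x r := by
      rw [← h1, ← view_add hyz (u := c y - y) (s := r), add_sub_cancel]
      rw [← dist_eq_norm, dist_comm]
      linarith
    obtain ⟨h4, h5⟩ := hceq z _ h3 (by
      rw [dist_eq_norm, sub_add_cancel_left, neg_sub, ← dist_eq_norm]
      exact h2)
    refine ⟨h4, ?_⟩
    rw [h5]
    abel
  have hpre : T.proj t ⁻¹' (T.proj t '' W) = W := by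
    refine (subset_preimage_image _ _).antisymm' ?_
    rintro z ⟨y, hy, hyz⟩
    exact (hsat y hy z (proj_eq_proj.1 hyz)).1
  have hVo : IsOpen (T.proj t '' W) := by
    rw [← (T.isQuotientMap_proj t).isOpen_preimage, hpre]
    exact hWo
  let σ := Function.surjInv (T.surjective_proj t)
  have hσ : ∀ k, T.proj t (σ k) = k := Function.surjInv_eq _
  have hw : ∀ y ∈ W, x + (σ (T.proj t y) - c (σ (T.proj t y))) = x + (y - c y) := fun y hy => by
    rw [(hsat y hy _ (proj_eq_proj.1 (hσ _)).symm).2]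
  refine ⟨T.proj t '' W, hVo, ⟨x, (hceq x x rfl (by simpa using hδ)).1, rfl⟩,
    fun k => x + (σ k - c (σ k)), ?_, ?_⟩
  · rw [(T.isQuotientMap_proj t).continuousOn_isOpen_iff hVo, hpre]
    have : ContinuousOn (fun y => x + (y - c y)) W := by
      refine continuousOn_of_forall_continuousAt fun y hy => ?_
      have : ContinuousAt (fun z => x + (z - c y)) y := by fun_prop
      refine this.congr ?_
      filter_upwards [hloc y hy] with z hz
      rw [hz.2]
    exact this.congr fun y hy => hw y hy
  · rintro _ ⟨y, hy, rfl⟩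
    change T.proj s (x + (σ (T.proj t y) - c (σ (T.proj t y)))) = T.proj s y
    rw [hw y hy, proj_eq_proj]
    obtain ⟨h1, h2⟩ := hc y hy
    rw [dist_eq_norm] at h2
    have := view_add h1 (u := y - c y) (s := s) (by linarith)
    rw [add_sub_cancel] at this
    exact this.symm

/-- Locally, the forgetful map `K_t → K_s` kills homotopy if `s < t`. -/
theorem exists_isOpen_homotopic (T : Tiling d L) {s t : ℝ} (hst : s < t) (ht : 0 < t)
    (k : T.Approximant t) : ∃ V, IsOpen V ∧ k ∈ V ∧ ∀ (a b : T.Approximant t) (γ γ' : Path a b),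
      (∀ r, γ r ∈ V) → (∀ r, γ' r ∈ V) →
        (γ.map (T.forget hst.le).continuous).Homotopic (γ'.map (T.forget hst.le).continuous) := by
  obtain ⟨V, hV, hk, w, hw, hwf⟩ := T.exists_local_lift hst ht k
  refine ⟨V, hV, hk, fun a b γ γ' hγ hγ' => ?_⟩
  have ha : T.forget hst.le a = T.proj s (w a) := (hwf a (by simpa using hγ 0)).symm
  have hb : T.forget hst.le b = T.proj s (w b) := (hwf b (by simpa using hγ 1)).symm
  -- Under `w`, both paths become paths in the simply connected `ℝ^d` with the same ends.
  let lift : ∀ δ : Path a b, (∀ r, δ r ∈ V) → Path (w a) (w b) := fun δ hδ =>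
    { toFun := fun r => w (δ r)
      continuous_toFun := hw.comp_continuous δ.continuous hδ
      source' := by simp
      target' := by simp }
  have key : ∀ (δ : Path a b) (hδ : ∀ r, δ r ∈ V), δ.map (T.forget hst.le).continuous =
      ((lift δ hδ).map (T.continuous_proj s)).cast ha hb := by
    intro δ hδ
    ext r
    exact (hwf _ (hδ r)).symm
  rw [key γ hγ, key γ' hγ']
  exact ((SimplyConnectedSpace.paths_homotopic (lift γ hγ) (lift γ' hγ')).map
    ⟨T.proj s, T.continuous_proj s⟩).pathCast ha hb

end Tiling

/-! ## Gauges and pattern equivariant bundles -/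

theorem HasCoord.congr {X Y P Q G : Type*} [TopologicalSpace X] [TopologicalSpace Y]
    [TopologicalSpace P] [TopologicalSpace Q] [Mul G] [TopologicalSpace G] {p : P → X} {q : Q → Y}
    {e : Bundle.Trivialization G p} {e' : Bundle.Trivialization G q} {F : P → Q} {f : X → Y}
    {h h' : X → G} (H : HasCoord e e' F h) (hF : ∀ z, q (F z) = f (p z))
    (hh : ∀ x ∈ e.baseSet, f x ∈ e'.baseSet → h' x = h x) : HasCoord e e' F h' := by
  intro z hz hz'
  rw [hh _ hz (hF z ▸ hz'), H z hz hz']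

namespace Gauge

variable {X : Type v} [TopologicalSpace X] {G : Type u} [Group G]

/-- The restriction of a gauge to a smaller cover. -/
def reindex {κ : Type*} (A : Gauge.{u, v, w} X G) (c : κ → A.ι) (hc : ∀ x, ∃ i, x ∈ A.V (c i)) :
    Gauge X G where
  ι := κ
  V i := A.V (c i)
  g i := A.g (c i)
  isOpen i := A.isOpen (c i)
  cover := hc
  locConst i j := A.locConst (c i) (c j)

theorem Hol.reindex {κ : Type*} {A : Gauge.{u, v, w} X G} {x₀ : X}
    {ρ : FundamentalGroup X x₀ →* G} (h : A.Hol x₀ ρ) (c : κ → A.ι)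
    (hc : ∀ x, ∃ i, x ∈ A.V (c i)) : (A.reindex c hc).Hol x₀ ρ := by
  obtain ⟨a, ha⟩ := h
  refine ⟨a, fun γ => ?_⟩
  rw [← ha γ]
  obtain ⟨v, hv, h0, h1⟩ := A.exists_hor γ 1
  have hv' : (A.reindex c hc).Hor γ v := fun i => hv (c i)
  have := hv'.transport_mul
  rw [h0, h1, mul_one, mul_one] at this
  rw [this]

theorem Mor.conj {A : Gauge.{u, v, w} X G} {A' : Gauge X G} {m : X → G} (h : A.Mor A' id m)
    {x₀ : X} {ρ σ : FundamentalGroup X x₀ →* G} (hρ : A.Hol x₀ ρ) (hσ : A'.Hol x₀ σ) :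
    (conjSetoid (FundamentalGroup X x₀) G).r ρ σ := by
  have := Hol.of_mor (f := ContinuousMap.id X) h hρ hσ
  have hid : σ.comp (FundamentalGroup.map (ContinuousMap.id X) x₀) = σ := by
    ext p
    induction p using Quotient.inductionOn
    rfl
  exact hid ▸ this

end Gauge

namespace Tiling

variable {d : ℕ} {L : Type v} {T : Tiling d L} {G : Type u} [Group G] [TopologicalSpace G]

theorem IsPEOn.of_proj {Y : Type*} {t : ℝ} (f : T.Approximant t → Y) (U : Set (Space d)) :
    T.IsPEOn t (fun x => f (T.proj t x)) U :=
  fun _ _ _ _ h => congrArg f (proj_eq_proj.2 h)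

namespace PEBundle

/-- The bundle `P` descends to `K_t`, where it is described by the gauge `A`. -/
structure Models (P : T.PEBundle G) (t : ℝ) (A : Gauge.{u, v, w} (T.Approximant t) G)
    (e : P.ι → A.ι) : Prop where
  surjective : Function.Surjective e
  baseSet_eq : ∀ i, (P.chart i).baseSet = T.proj t ⁻¹' A.V (e i)
  isGauge : P.toFlatBundle.IsGauge fun i x => A.g (e i) (T.proj t x)

/-- A PE bundle with radius at most `t` descends to `K_t`. -/
theorem exists_models (P : T.PEBundle G) {t : ℝ} (ht : P.radius ≤ t) :
    ∃ (A : Gauge.{u, v, max u v} (T.Approximant t) G) (e : P.ι → A.ι), P.Models t A e := by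
  obtain ⟨g, hg⟩ := P.toFlatBundle.exists_isGauge
  let σ := Function.surjInv (T.surjective_proj t)
  have hσ : ∀ x, T.view (σ (T.proj t x)) t = T.view x t := fun x =>
    proj_eq_proj.1 (Function.surjInv_eq (T.surjective_proj t) _)
  have hU : ∀ i, ∀ x ∈ (P.chart i).baseSet, ∀ y, T.view x t = T.view y t →
      y ∈ (P.chart i).baseSet := fun i x hx y hxy => P.isPESet i x hx y (view_eq_of_le ht hxy)
  have hpre : ∀ i, T.proj t ⁻¹' (T.proj t '' (P.chart i).baseSet) = (P.chart i).baseSet := by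
    intro i
    refine (subset_preimage_image _ _).antisymm' ?_
    rintro x ⟨y, hy, hxy⟩
    exact hU i y hy x (proj_eq_proj.1 hxy)
  have hinv : ∀ i j, ∀ x ∈ (P.chart i).baseSet, x ∈ (P.chart j).baseSet →
      g j (σ (T.proj t x)) * (g i (σ (T.proj t x)))⁻¹ = g j x * (g i x)⁻¹ := by
    intro i j x hi hj
    obtain ⟨h, hc, hp⟩ := P.transition_isPEOn i j
    have hi' := hU i x hi _ (hσ x).symm
    have hj' := hU j x hj _ (hσ x).symm
    rw [hg.eq_of_hasCoord hc hi hj, hg.eq_of_hasCoord hc hi' hj']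
    exact hp _ ⟨hi', hj'⟩ _ ⟨hi, hj⟩ (view_eq_of_le ht (hσ x))
  have ho : ∀ i, IsOpen (T.proj t '' (P.chart i).baseSet) := fun i => by
    rw [← (T.isQuotientMap_proj t).isOpen_preimage, hpre]
    exact (P.chart i).open_baseSet
  let A : Gauge.{u, v, max u v} (T.Approximant t) G :=
    { ι := ULift.{v} P.ι
      V := fun i => T.proj t '' (P.chart i.down).baseSet
      -- The section behind `g` need not be PE, so `g i` is read off at one representative of each
      -- class; by `hinv` the transition functions are unchanged.
      g := fun i k => g i.down (σ k)
      isOpen := fun i => ho i.down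
      cover := fun k => by
        obtain ⟨x, rfl⟩ := T.surjective_proj t k
        obtain ⟨i, hi⟩ := P.cover x
        exact ⟨⟨i⟩, x, hi, rfl⟩
      locConst := fun i j => by
        rw [(T.isQuotientMap_proj t).locConstOn_iff ((ho _).inter (ho _)), preimage_inter,
          hpre, hpre]
        exact (hg.toGauge.locConst i.down j.down).congr fun x hx =>
          hinv i.down j.down x hx.1 hx.2 }
  exact ⟨A, ULift.up, ULift.up_surjective, fun i => (hpre i).symm, fun i j =>
    (hg i j).congr (f := id) (fun z => rfl) (hinv i j)⟩

/-- Every gauge over `K_t` describes a PE bundle, up to a change of the cover. -/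
theorem exists_models_of_gauge {t : ℝ} (ht : 0 < t) [ContinuousMul G]
    (A : Gauge.{u, v, w} (T.Approximant t) G) :
    ∃ (P : T.PEBundle G) (A' : Gauge.{u, v, max u v} (T.Approximant t) G) (e : P.ι → A'.ι),
      P.Models t A' e ∧ ∀ x₀ ρ, A.Hol x₀ ρ → A'.Hol x₀ ρ := by
  -- Keeping one chart per point of `ℝ^d` still covers `K_t` and brings the index type into the
  -- universe required of a PE bundle.
  choose c hc using fun x : Space d => A.cover (T.proj t x)
  have hcov : ∀ k, ∃ i : ULift.{max u v} (Space d), k ∈ A.V (c i.down) := fun k => by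
    obtain ⟨x, rfl⟩ := T.surjective_proj t k
    exact ⟨⟨x⟩, hc x⟩
  let B : Gauge.{u, 0, u} (Space d) G :=
    { ι := ULift.{u} (Space d)
      V := fun i => T.proj t ⁻¹' A.V (c i.down)
      g := fun i x => A.g (c i.down) (T.proj t x)
      isOpen := fun i => (A.isOpen _).preimage (T.continuous_proj t)
      cover := fun x => ⟨⟨x⟩, hc x⟩
      locConst := fun i j => (A.locConst (c i.down) (c j.down)).preimage (T.continuous_proj t) }
  let P : T.PEBundle G :=
    { B.toFlatBundle with
      radius := t
      radius_pos := ht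
      isPESet := fun i x hx y hxy => by
        change T.proj t y ∈ A.V (c i.down)
        rw [← proj_eq_proj.2 hxy]
        exact hx
      transition_isPEOn := fun i j => ⟨_, B.isGauge_toFlatBundle i j,
        IsPEOn.of_proj (fun k => A.g (c j.down) k * (A.g (c i.down) k)⁻¹) _⟩ }
  exact ⟨P, A.reindex (fun i : ULift.{max u v} (Space d) => c i.down) hcov,
    fun i => ⟨i.down⟩, ⟨fun i => ⟨⟨i.down⟩, rfl⟩, fun i => rfl, B.isGauge_toFlatBundle⟩,
    fun x₀ ρ h => h.reindex _ hcov⟩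

/-- A PE bundle is the pullback of the bundle over `K_t` to which it descends. -/
theorem Models.isPullback [ContinuousMul G] {P : T.PEBundle G} {t : ℝ}
    {A : Gauge.{u, v, max u v} (T.Approximant t) G} {e : P.ι → A.ι} (h : P.Models t A e) :
    P.IsPullback t A.toFlatBundle := by
  have hl : ∀ i j, LocConstOn (fun x => A.g j (T.proj t x) * (1 : Space d → G) x *
      (A.g (e i) (T.proj t x))⁻¹) ((P.chart i).baseSet ∩ T.proj t ⁻¹' A.V j) := by
    intro i j
    rw [h.baseSet_eq]
    exact ((A.locConst (e i) j).preimage (T.continuous_proj t)).congr fun x _ => by simp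
  refine ⟨_, h.isGauge.continuous_mapOfCoord A.isGauge_toFlatBundle (T.continuous_proj t) hl,
    FlatBundle.proj_mapOfCoord _ _, fun i j =>
    ⟨_, h.isGauge.hasCoord_mapOfCoord A.isGauge_toFlatBundle _ _ i j, hl i j, ?_⟩⟩
  exact IsPEOn.of_proj (fun k => A.g j k * 1 * (A.g (e i) k)⁻¹) _

/-- Bundle maps with PE coordinates descend. -/
theorem Models.exists_mor {P : T.PEBundle G} {t : ℝ} {A : Gauge.{u, v, w} (T.Approximant t) G}
    {e : P.ι → A.ι} (h : P.Models t A e) {Y : Type*} [TopologicalSpace Y] {B : Gauge Y G}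
    {f : T.Approximant t → Y} (hf : Continuous f) {κ : Type*} {c : κ → B.ι}
    (hc : Function.Surjective c) {m : Space d → G}
    (hm : ∀ i j, ∃ b : Space d → G,
      (∀ x ∈ (P.chart i).baseSet, f (T.proj t x) ∈ B.V (c j) →
        B.g (c j) (f (T.proj t x)) * m x * (A.g (e i) (T.proj t x))⁻¹ = b x) ∧
      LocConstOn b ((P.chart i).baseSet ∩ (fun x => f (T.proj t x)) ⁻¹' B.V (c j)) ∧
      T.IsPEOn t b ((P.chart i).baseSet ∩ (fun x => f (T.proj t x)) ⁻¹' B.V (c j))) :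
    ∃ n, A.Mor B f n := by
  let σ := Function.surjInv (T.surjective_proj t)
  have hσ : ∀ x, T.proj t (σ (T.proj t x)) = T.proj t x := fun x =>
    Function.surjInv_eq (T.surjective_proj t) _
  -- In the formula for `b`, every factor other than `m` depends only on the class in `K_t`, and so
  -- does `b`; hence `m` does too.
  have hmσ : ∀ x, m (σ (T.proj t x)) = m x := by
    intro x
    obtain ⟨i, hi⟩ := P.cover x
    obtain ⟨j, hj⟩ := B.cover (f (T.proj t x))
    obtain ⟨j, rfl⟩ := hc j
    obtain ⟨b, hb, -, hp⟩ := hm i j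
    have hi' : σ (T.proj t x) ∈ (P.chart i).baseSet := by
      rw [h.baseSet_eq, mem_preimage] at hi ⊢
      rwa [hσ]
    have hj' : f (T.proj t (σ (T.proj t x))) ∈ B.V (c j) := by rwa [hσ]
    have h1 := hb _ hi hj
    have h2 := hb _ hi' hj'
    rw [hp _ ⟨hi', hj'⟩ _ ⟨hi, hj⟩ (proj_eq_proj.1 (hσ x)), ← h1, hσ] at h2
    exact mul_left_cancel (mul_right_cancel h2)
  refine ⟨fun k => m (σ k), fun i j => ?_⟩
  obtain ⟨i, rfl⟩ := h.surjective i
  obtain ⟨j, rfl⟩ := hc j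
  obtain ⟨b, hb, hl, -⟩ := hm i j
  rw [(T.isQuotientMap_proj t).locConstOn_iff ((A.isOpen _).inter ((B.isOpen _).preimage hf)),
    preimage_inter, ← h.baseSet_eq]
  refine hl.congr fun x hx => ?_
  simp only [hmσ]
  exact hb x hx.1 hx.2

/-- As `π_s` is `π_t` followed by the forgetful map, the bundle map `P → Q` descends to one over the
forgetful map. -/
theorem Models.exists_mor_of_isPullback {P : T.PEBundle G} {s t : ℝ}
    {A : Gauge.{u, v, w} (T.Approximant t) G} {e : P.ι → A.ι} (h : P.Models t A e) (hst : s ≤ t)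
    {Q : FlatBundle (T.Approximant s) G} (hQ : P.IsPullback s Q)
    {k : Q.ι → T.Approximant s → G} (hk : Q.IsGauge k) :
    ∃ m, A.Mor hk.toGauge (T.forget hst) m := by
  obtain ⟨F, -, hF, H⟩ := hQ
  obtain ⟨m, hm⟩ := h.isGauge.exists_coord hk hF
  refine h.exists_mor (m := m) (T.forget hst).continuous (c := id) Function.surjective_id
    fun i j => ?_
  obtain ⟨b, hb, hl, hp⟩ := H i j
  exact ⟨b, hm i j b hb, hl, fun x hx y hy hxy => hp x hx y hy (view_eq_of_le hst hxy)⟩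

theorem Models.exists_mor_of_isoAt {P P' : T.PEBundle G} {s t : ℝ}
    {A : Gauge.{u, v, w} (T.Approximant t) G} {e : P.ι → A.ι} (h : P.Models t A e)
    {A' : Gauge (T.Approximant t) G} {e' : P'.ι → A'.ι} (h' : P'.Models t A' e') (hst : s ≤ t)
    (hP : IsoAt s P P') : ∃ m, A.Mor A' id m := by
  obtain ⟨F, hF, H⟩ := hP
  obtain ⟨m, hm⟩ := h.isGauge.exists_coord (f := id) h'.isGauge hF
  refine h.exists_mor (m := m) continuous_id h'.surjective fun i j => ?_
  obtain ⟨b, hb, hl, hp⟩ := H i j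
  have := hm i j b hb
  rw [h'.baseSet_eq] at hl hp this
  exact ⟨b, this, hl, fun x hx y hy hxy => hp x hx y hy (view_eq_of_le hst hxy)⟩

/-- The flat map over `K_t` is pulled back along `π_t`, which makes its coordinates PE with radius
`t`. -/
theorem Models.isoAt [ContinuousMul G] {P P' : T.PEBundle G} {t : ℝ}
    {A : Gauge.{u, v, w} (T.Approximant t) G} {e : P.ι → A.ι} (h : P.Models t A e)
    {A' : Gauge (T.Approximant t) G} {e' : P'.ι → A'.ι} (h' : P'.Models t A' e')
    {m : T.Approximant t → G} (hm : A.Mor A' id m) : IsoAt t P P' := by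
  have hl : ∀ i j, LocConstOn (fun x => A'.g (e' j) (T.proj t x) * m (T.proj t x) *
      (A.g (e i) (T.proj t x))⁻¹) ((P.chart i).baseSet ∩ (P'.chart j).baseSet) := by
    intro i j
    rw [h.baseSet_eq, h'.baseSet_eq]
    exact (hm (e i) (e' j)).preimage (T.continuous_proj t)
  obtain ⟨F, hF⟩ := h.isGauge.exists_homeomorph h'.isGauge (m := fun x => m (T.proj t x)) hl
  refine ⟨F, fun z => by rw [hF]; exact FlatBundle.proj_mapOfCoord _ _ _, fun i j =>
    ⟨_, ?_, hl i j, IsPEOn.of_proj (fun k => A'.g (e' j) k * m k * (A.g (e i) k)⁻¹) _⟩⟩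
  rw [funext hF]
  exact h.isGauge.hasCoord_mapOfCoord h'.isGauge id _ i j

/-- The class of the holonomy of a PE bundle at level `t` comes from the holonomies at lower
levels. -/
theorem Models.repMap_eq {P : T.PEBundle G} {s t : ℝ}
    {A : Gauge.{u, v, w} (T.Approximant t) G} {e : P.ι → A.ι} (h : P.Models t A e) (hst : s ≤ t)
    {Q : FlatBundle (T.Approximant s) G} (hQ : P.IsPullback s Q) {ρ : T.ApproxGroup s →* G}
    (hρ : Q.HasHolonomy (T.proj s 0) ρ) {σ : T.ApproxGroup t →* G} (hσ : A.Hol (T.proj t 0) σ) :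
    T.repMap G hst (RepVariety.mk ρ) = RepVariety.mk σ := by
  obtain ⟨k, hk⟩ := Q.exists_isGauge
  obtain ⟨m, hm⟩ := h.exists_mor_of_isPullback hst hQ hk
  exact Quotient.sound ((conjSetoid _ G).symm (hσ.of_mor hm (hk.hol hρ)))

end PEBundle

/-! ### Passage to the direct limit -/

theorem RepLimit.mk_eq (T : Tiling d L) {G : Type u} [Group G] {t : ℕ → ℝ} (ht : Monotone t) {n m : ℕ} (h : n ≤ m)
    (ρ : T.ApproxGroup (t n) →* G) {σ : T.ApproxGroup (t m) →* G}
    (hσ : T.repMap G (ht h) (RepVariety.mk ρ) = RepVariety.mk σ) :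
    RepLimit.mk T t ht n ρ = RepLimit.mk T t ht m σ := by
  rw [RepLimit.mk, RepLimit.mk, ← hσ]
  exact DirectLimit.eq_of_le (f := fun _ _ h => T.repMap G (ht h)) ⟨n, RepVariety.mk ρ⟩ m h

/-- At a stage `m` beyond `n`, `n'` and the radius of the equivalence, both bundles and the
isomorphism descend, so the holonomies there, which represent the images of `ρ` and `ρ'`, are
conjugate. With `P = P'` this is independence of all choices. -/
theorem PEBundle.Equivalent.repLimit_mk_eq {t : ℕ → ℝ} (ht : Monotone t)
    (ht' : Tendsto t atTop atTop) {P P' : T.PEBundle G} (h : PEBundle.Equivalent P P') {n n' : ℕ}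
    {Q : FlatBundle (T.Approximant (t n)) G} {ρ : T.ApproxGroup (t n) →* G}
    (hQ : P.IsPullback (t n) Q) (hρ : Q.HasHolonomy (T.proj (t n) 0) ρ)
    {Q' : FlatBundle (T.Approximant (t n')) G} {ρ' : T.ApproxGroup (t n') →* G}
    (hQ' : P'.IsPullback (t n') Q') (hρ' : Q'.HasHolonomy (T.proj (t n') 0) ρ') :
    RepLimit.mk T t ht n ρ = RepLimit.mk T t ht n' ρ' := by
  obtain ⟨s, hs, hs', hiso⟩ := h
  obtain ⟨m, hm, hn, hn'⟩ := ((ht'.eventually_ge_atTop s).and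
    ((eventually_ge_atTop n).and (eventually_ge_atTop n'))).exists
  obtain ⟨A, e, hA⟩ := P.exists_models (hs.le.trans hm)
  obtain ⟨A', e', hA'⟩ := P'.exists_models (hs'.le.trans hm)
  obtain ⟨f, hf⟩ := hA.exists_mor_of_isoAt hA' hm hiso
  obtain ⟨σ, hσ⟩ := A.exists_hol (T.proj (t m) 0)
  obtain ⟨σ', hσ'⟩ := A'.exists_hol (T.proj (t m) 0)
  rw [RepLimit.mk_eq T ht hn ρ (hA.repMap_eq (ht hn) hQ hρ hσ),
    RepLimit.mk_eq T ht hn' ρ' (hA'.repMap_eq (ht hn') hQ' hρ' hσ')]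
  exact congrArg (fun c => (Quotient.mk _ ⟨m, c⟩ : T.RepLimit G t ht))
    (Quotient.sound (hf.conj hσ hσ'))

theorem PEBundle.exists_isPullback_hasHolonomy [ContinuousMul G] (P : T.PEBundle G) {t : ℝ}
    (ht : P.radius ≤ t) : ∃ (Q : FlatBundle (T.Approximant t) G) (ρ : T.ApproxGroup t →* G),
      P.IsPullback t Q ∧ Q.HasHolonomy (T.proj t 0) ρ := by
  obtain ⟨A, e, hA⟩ := P.exists_models ht
  obtain ⟨ρ, hρ⟩ := A.exists_hol (T.proj t 0)
  exact ⟨_, ρ, hA.isPullback, Gauge.hasHolonomy_toFlatBundle hρ⟩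

/-- Equality in the limit holds at a finite stage, which can be moved strictly beyond both radii.
There the two descended bundles have conjugate holonomies, hence are isomorphic. -/
theorem PEBundle.equivalent_of_repLimit_mk_eq [ContinuousMul G] {t : ℕ → ℝ} (ht : Monotone t)
    (ht' : Tendsto t atTop atTop) {P P' : T.PEBundle G} {n n' : ℕ}
    {Q : FlatBundle (T.Approximant (t n)) G} {ρ : T.ApproxGroup (t n) →* G}
    (hQ : P.IsPullback (t n) Q) (hρ : Q.HasHolonomy (T.proj (t n) 0) ρ)
    {Q' : FlatBundle (T.Approximant (t n')) G} {ρ' : T.ApproxGroup (t n') →* G}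
    (hQ' : P'.IsPullback (t n') Q') (hρ' : Q'.HasHolonomy (T.proj (t n') 0) ρ')
    (h : RepLimit.mk T t ht n ρ = RepLimit.mk T t ht n' ρ') : PEBundle.Equivalent P P' := by
  obtain ⟨l, hl, hl', hll⟩ := Quotient.exact h
  obtain ⟨m, hm, hP, hP'⟩ := ((eventually_ge_atTop l).and
    ((ht'.eventually_gt_atTop P.radius).and (ht'.eventually_gt_atTop P'.radius))).exists
  obtain ⟨A, e, hA⟩ := P.exists_models hP.le
  obtain ⟨A', e', hA'⟩ := P'.exists_models hP'.le
  obtain ⟨σ, hσ⟩ := A.exists_hol (T.proj (t m) 0)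
  obtain ⟨σ', hσ'⟩ := A'.exists_hol (T.proj (t m) 0)
  have h1 := hA.repMap_eq (ht (hl.trans hm)) hQ hρ hσ
  have h2 := hA'.repMap_eq (ht (hl'.trans hm)) hQ' hρ' hσ'
  have h3 : (RepVariety.mk σ' : T.Rep G (t m)) = RepVariety.mk σ := by
    rw [← h1, ← h2]
    have hll' := congrArg (T.repMap G (ht hm)) hll
    have e1 := DirectedSystem.map_map' (fun _ _ h => T.repMap G (ht h)) hl hm (RepVariety.mk ρ)
    have e2 := DirectedSystem.map_map' (fun _ _ h => T.repMap G (ht h)) hl' hm (RepVariety.mk ρ')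
    exact e2.symm.trans (hll'.symm.trans e1)
  obtain ⟨f, hf⟩ := Gauge.exists_mor_of_hol hσ (hσ'.conj (Quotient.exact h3))
  exact ⟨t m, hP, hP', hA.isoAt hA' hf⟩

/-- This is surjectivity: the pullback of `ρ` to a later stage with `t m > t n` is realised, and it
has the same class in the limit. -/
theorem exists_peBundle_hasHolonomy [ContinuousMul G] {t : ℕ → ℝ} (ht : Monotone t)
    (ht' : Tendsto t atTop atTop) (n : ℕ) (ρ : T.ApproxGroup (t n) →* G) :
    ∃ (P : T.PEBundle G) (m : ℕ) (Q : FlatBundle (T.Approximant (t m)) G)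
      (σ : T.ApproxGroup (t m) →* G), P.IsPullback (t m) Q ∧ Q.HasHolonomy (T.proj (t m) 0) σ ∧
        RepLimit.mk T t ht m σ = RepLimit.mk T t ht n ρ := by
  obtain ⟨m, hnm, hm, hm'⟩ := ((eventually_ge_atTop n).and
    ((ht'.eventually_gt_atTop (t n)).and (ht'.eventually_gt_atTop 0))).exists
  obtain ⟨A, hA⟩ := Gauge.exists_hol_eq (T.forget hm.le) (T.proj (t m) 0) ρ
    (T.exists_isOpen_homotopic hm hm')
  obtain ⟨P, A', e, hP, hA'⟩ := PEBundle.exists_models_of_gauge hm' A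
  exact ⟨P, m, A'.toFlatBundle, ρ.comp (T.forgetHom (ht hnm)), hP.isPullback,
    Gauge.hasHolonomy_toFlatBundle (hA' _ _ hA), (RepLimit.mk_eq T ht hnm ρ rfl).symm⟩

end Tiling

theorem theorem1p1 {d : ℕ} {L : Type v} (T : Tiling d L) (G : Type u) [Group G]
    [TopologicalSpace G] [IsTopologicalGroup G] (t : ℕ → ℝ) (ht : Monotone t)
    (ht' : Tendsto t atTop atTop) :
    (∀ (n : ℕ) (P : T.PEBundle G), P.radius ≤ t n →
      ∃ (Q : FlatBundle (T.Approximant (t n)) G) (ρ : T.ApproxGroup (t n) →* G),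
        P.IsPullback (t n) Q ∧ Q.HasHolonomy (T.proj (t n) 0) ρ) ∧
    ∃ Φ : T.PREP G ≃ T.RepLimit G t ht,
      ∀ (n : ℕ) (P : T.PEBundle G) (Q : FlatBundle (T.Approximant (t n)) G)
        (ρ : T.ApproxGroup (t n) →* G),
        P.IsPullback (t n) Q → Q.HasHolonomy (T.proj (t n) 0) ρ →
          Φ (Tiling.PREP.mk P) = Tiling.RepLimit.mk T t ht n ρ := by
  have h1 : ∀ (n : ℕ) (P : T.PEBundle G), P.radius ≤ t n →
      ∃ (Q : FlatBundle (T.Approximant (t n)) G) (ρ : T.ApproxGroup (t n) →* G),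
        P.IsPullback (t n) Q ∧ Q.HasHolonomy (T.proj (t n) 0) ρ :=
    fun n P hP => P.exists_isPullback_hasHolonomy hP
  refine ⟨h1, ?_⟩
  -- The stage, the bundle `Q` and `ρ` are chosen arbitrarily for each `P`; `hΦ` shows that every
  -- other choice gives the same class.
  choose n hn using fun P : T.PEBundle G => (ht'.eventually_ge_atTop P.radius).exists
  choose Q ρ hQ hρ using fun P : T.PEBundle G => h1 (n P) P (hn P)
  let Φ : T.PREP G → T.RepLimit G t ht :=
    Quotient.lift (fun P => Tiling.RepLimit.mk T t ht (n P) (ρ P)) fun P P' h =>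
      h.repLimit_mk_eq ht ht' (hQ P) (hρ P) (hQ P') (hρ P')
  have hΦ : ∀ (n : ℕ) (P : T.PEBundle G) (Q : FlatBundle (T.Approximant (t n)) G)
      (ρ : T.ApproxGroup (t n) →* G), P.IsPullback (t n) Q →
        Q.HasHolonomy (T.proj (t n) 0) ρ →
          Φ (Tiling.PREP.mk P) = Tiling.RepLimit.mk T t ht n ρ := fun m P R σ hR hσ =>
    (Tiling.PEBundle.Equivalent.refl P).repLimit_mk_eq ht ht' (hQ P) (hρ P) hR hσ
  refine ⟨Equiv.ofBijective Φ ⟨fun a b hab => ?_, fun c => ?_⟩, hΦ⟩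
  · induction a using Quotient.inductionOn with
    | h P =>
      induction b using Quotient.inductionOn with
      | h P' =>
        exact Quotient.sound (Tiling.PEBundle.equivalent_of_repLimit_mk_eq ht ht' (hQ P) (hρ P)
          (hQ P') (hρ P') hab)
  · induction c using Quotient.inductionOn with
    | h c =>
      obtain ⟨m, c⟩ := c
      induction c using Quotient.inductionOn with
      | h σ =>
        obtain ⟨P, l, R, τ, hR, hτ, h⟩ := Tiling.exists_peBundle_hasHolonomy ht ht' m σ
        exact ⟨Tiling.PREP.mk P, (hΦ l P R τ hR hτ).trans h⟩
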